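/- Let $d,n,s$ be positive integers with $d\ge 2$ and $1\le s<d$, and let $\sigma>0$, $\lambda>0$. For $\theta=(\mu_1,\mu_2)\in\mathbb{R}^d\times\mathbb{R}^d$ let $P_\theta=\frac12\mathcal N(\mu_1,\sigma^2I)+\frac12\mathcal N(\mu_2,\sigma^2I)$, and let $$\Theta_{\lambda,s}=\{(\mu_1,\mu_2):\ \|\mu_1-\mu_2\|\ge\lambda,\ \|\mu_1-\mu_2\|_0\le s\},$$ where $\|\cdot\|$ is the Euclidean norm and $\|\cdot\|_0$ counts the nonzero coordinates. Let $F_\theta(x)=\operatorname{argmax}_{i\in\{1,2\}}f(x;\mu_i,\sigma^2I)$, where $f(\cdot;\mu,\Sigma)$ is the density of $\mathcal N(\mu,\Sigma)$, and for $F:\mathbb{R}^d\to\{1,2\}$ let $$L_\theta(F)=\min_\pi P_\theta\big(\{x:\ F_\theta(x)\ne\pi(F(x))\}\big),$$ the minimum being over the permutations $\pi$ of $\{1,2\}$. Given $X_1,\dots,X_n$ i.i.d. from $P_\theta$, let $\widehat\mu_n=\frac1n\sum_kX_k$, $\widehat\Sigma_n=\frac1n\sum_k(X_k-\widehat\mu_n)(X_k-\widehat\mu_n)^T$,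 and $$\alpha=\sqrt{\frac{6\log(nd)}{n}}+\frac{2\log(nd)}{n},\qquad \widehat\tau_n=\frac{1+\alpha}{1-\alpha}\min_{1\le i\le d}\widehat\Sigma_n(i,i),\qquad \widehat S_n=\{i:\ \widehat\Sigma_n(i,i)>\widehat\tau_n\}.$$ Let $\widehat\Sigma_{\widehat S_n}$ be the matrix that agrees with $\widehat\Sigma_n$ on the rows and columns in $\widehat S_n$ and is $0$ elsewhere, let $v_1(\widehat\Sigma_{\widehat S_n})$ be any unit eigenvector for its largest eigenvalue, and let $x_{\widehat S_n}$, $\widehat\mu_{\widehat S_n}$ be $x$, $\widehat\mu_n$ with the coordinates outside $\widehat S_n$ set to $0$. Define $\widehat F_n(x)=1$ if $x_{\widehat S_n}^Tv_1(\widehat\Sigma_{\widehat S_n})\ge\widehat\mu_{\widehat S_n}^Tv_1(\widehat\Sigma_{\widehat S_n})$ and $\widehat F_n(x)=2$ otherwise. If $n\ge\max(68,4s)$ and $\alpha\le\frac14$, then $$\sup_{\theta\in\Theta_{\lambda,s}}\mathbb E_\theta L_\theta(\widehat F_n)\ \le\ 603\max\Big(\frac{16\sigma^2}{\lambda^2},1\Big)\sqrt{\frac{s\log(ns)}{n}}+220\,\frac{\sigma\sqrt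 s}{\lambda}\Big(\frac{\log(nd)}{n}\Big)^{1/4}.$$ -/

import Mathlib

namespace SparseMixture

open MeasureTheory

/-- The density at `x` of the isotropic Gaussian `N(m, σ² I)` on `ℝᵈ`. -/
noncomputable def gaussianDensity {d : ℕ} (σ : ℝ) (m x : EuclideanSpace ℝ (Fin d)) : ℝ :=
  (2 * Real.pi * σ ^ 2) ^ (-(d : ℝ) / 2) * Real.exp (-‖x - m‖ ^ 2 / (2 * σ ^ 2))

/-- The law `P_θ`, `θ = (μ₁, μ₂)`: the equal-weight mixture of `N(μ₁, σ² I)` and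
`N(μ₂, σ² I)`. -/
noncomputable def mixture {d : ℕ} (σ : ℝ)
    (θ : EuclideanSpace ℝ (Fin d) × EuclideanSpace ℝ (Fin d)) :
    Measure (EuclideanSpace ℝ (Fin d)) :=
  (2⁻¹ : ENNReal) •
      ProbabilityTheory.multivariateGaussian θ.1 (σ ^ 2 • (1 : Matrix (Fin d) (Fin d) ℝ)) +
    (2⁻¹ : ENNReal) •
      ProbabilityTheory.multivariateGaussian θ.2 (σ ^ 2 • (1 : Matrix (Fin d) (Fin d) ℝ))

/-- The law of an i.i.d. sample `X₁, …, Xₙ` from `P_θ`. -/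
noncomputable def sampleLaw {d : ℕ} (σ : ℝ) (n : ℕ)
    (θ : EuclideanSpace ℝ (Fin d) × EuclideanSpace ℝ (Fin d)) :
    Measure (Fin n → EuclideanSpace ℝ (Fin d)) :=
  Measure.pi fun _ => mixture σ θ

/-- The parameter class `Θ_{λ,s}`: pairs of means at Euclidean distance at least `λ`
that differ in at most `s` coordinates. -/
def sparseClass (d : ℕ) (lam : ℝ) (s : ℕ) :
    Set (EuclideanSpace ℝ (Fin d) × EuclideanSpace ℝ (Fin d)) :=
  {θ | lam ≤ ‖θ.1 - θ.2‖ ∧ hammingNorm (fun i => θ.1 i - θ.2 i) ≤ s}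

/-- The Bayes classifier `F_θ(x) = argmax_i f(x; μ_i, σ² I)`. The clusters `1, 2` are the
elements `0, 1` of `Fin 2`; a tie (a null event when `μ₁ ≠ μ₂`) goes to the first cluster. -/
noncomputable def bayes {d : ℕ} (σ : ℝ)
    (θ : EuclideanSpace ℝ (Fin d) × EuclideanSpace ℝ (Fin d))
    (x : EuclideanSpace ℝ (Fin d)) : Fin 2 :=
  open Classical in
  if gaussianDensity σ θ.2 x ≤ gaussianDensity σ θ.1 x then 0 else 1

/-- The clustering loss `L_θ(F) = min_π P_θ {x : F_θ(x) ≠ π(F(x))}`, the minimum being over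
the permutations `π` of the two labels. -/
noncomputable def loss {d : ℕ} (σ : ℝ)
    (θ : EuclideanSpace ℝ (Fin d) × EuclideanSpace ℝ (Fin d))
    (F : EuclideanSpace ℝ (Fin d) → Fin 2) : ENNReal :=
  ⨅ π : Equiv.Perm (Fin 2), mixture σ θ {x | bayes σ θ x ≠ π (F x)}

/-- The sample mean. -/
noncomputable def sampleMean {d n : ℕ} (X : Fin n → EuclideanSpace ℝ (Fin d)) :
    EuclideanSpace ℝ (Fin d) :=
  (n : ℝ)⁻¹ • ∑ k, X k

/-- The sample covariance `n⁻¹ ∑ₖ (Xₖ - μ̂)(Xₖ - μ̂)ᵀ`. -/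
noncomputable def sampleCov {d n : ℕ} (X : Fin n → EuclideanSpace ℝ (Fin d)) :
    Matrix (Fin d) (Fin d) ℝ :=
  Matrix.of fun i j =>
    (n : ℝ)⁻¹ * ∑ k, (X k i - sampleMean X i) * (X k j - sampleMean X j)

/-- `α = √(6 log(nd) / n) + 2 log(nd) / n`. -/
noncomputable def alpha (n d : ℕ) : ℝ :=
  Real.sqrt (6 * Real.log ((n : ℝ) * d) / n) + 2 * Real.log ((n : ℝ) * d) / n

/-- The threshold `τ̂ = (1 + α) / (1 - α) * min_i Σ̂(i,i)`. -/
noncomputable def threshold {d n : ℕ} (X : Fin n → EuclideanSpace ℝ (Fin d)) : ℝ :=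
  (1 + alpha n d) / (1 - alpha n d) * ⨅ i, sampleCov X i i

/-- The selected coordinates `Ŝ = {i : Σ̂(i,i) > τ̂}`. -/
noncomputable def selected {d n : ℕ} (X : Fin n → EuclideanSpace ℝ (Fin d)) : Finset (Fin d) :=
  open Classical in
  Finset.univ.filter fun i => threshold X < sampleCov X i i

/-- The matrix that agrees with `A` on the rows and columns in `S` and is `0` elsewhere. -/
def restrict {d : ℕ} (S : Finset (Fin d)) (A : Matrix (Fin d) (Fin d) ℝ) :
    Matrix (Fin d) (Fin d) ℝ :=
  Matrix.of fun i j => if i ∈ S ∧ j ∈ S then A i j else 0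

/-- `v` is a unit eigenvector of `A` for the largest eigenvalue of `A`. -/
def IsLeadingEigenvector {d : ℕ} (A : Matrix (Fin d) (Fin d) ℝ)
    (v : EuclideanSpace ℝ (Fin d)) : Prop :=
  ‖v‖ = 1 ∧ ∃ c : ℝ, A.mulVec v.ofLp = c • v.ofLp ∧
    ∀ (c' : ℝ) (w : Fin d → ℝ), w ≠ 0 → A.mulVec w = c' • w → c' ≤ c

/-- The clusterer that compares the projections on `v` of `x` and of the sample mean, both
restricted to the selected coordinates: the first cluster iff `x_Ŝᵀ v ≥ μ̂_Ŝᵀ v`. -/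
noncomputable def clusterer {d n : ℕ} (X : Fin n → EuclideanSpace ℝ (Fin d))
    (v x : EuclideanSpace ℝ (Fin d)) : Fin 2 :=
  open Classical in
  if ∑ i ∈ selected X, sampleMean X i * v i ≤ ∑ i ∈ selected X, x i * v i then 0 else 1

end SparseMixture

namespace SparseMixture

open MeasureTheory ProbabilityTheory Real
open scoped ENNReal NNReal RealInnerProductSpace


/-! Write `c` for the midpoint of the means and `m` for half their difference. The mixture has mean
`c` and covariance `σ² I + m mᵀ`, so its leading eigenvector is the discriminant direction `m`, and
a coordinate has variance above `σ²` exactly when it belongs to the support of `m`. The clusterer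
estimates both facts from the sample covariance.

Selection. With probability at least `1 - 4 / n` every sample variance is within a factor `1 ± α` of
the true one (`sampleCov_diag_concentration`). Since `s < d`, some coordinate has variance exactly
`σ²`, so the smallest sample variance calibrates the threshold: no irrelevant coordinate is
selected, and each missed one has `m i ^ 2` of order `α σ²`. The missed part of the signal produces
the `n^(-1/4)` term.

Direction. The selected set is random, but on this event it lies in the fixed support `S` of `m`.
The covariance error is therefore dominated by `frobNoise` and `meanNoise` on `S`, whose
expectations are exact variance computations; no matrix concentration is needed. A sine-theta
argument (`leadingEigenvector_angle`) turns the error into an angle.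

Loss. A linear rule disagrees with the Bayes rule, after matching labels, only in a thickened double
cone around the Bayes hyperplane. The coordinate along `m` is independent of the coordinate across
it, so one-dimensional anti-concentration bounds the Gaussian mass of the cone (`gauss_cone_le`,
`loss_linear_le`) by the tangent of the angle plus an offset term coming from the error of the
sample mean.

The resulting bound is linearised in the two noises and integrated in `lintegral_loss_clusterer_le`;
`rate_le` compares the outcome with the stated rate. As the loss is at most 1, only the case of a
right-hand side below 1 matters. -/

/-- The isotropic Gaussian law `N(m, σ² I)`. -/
noncomputable abbrev gauss {d : ℕ} (σ : ℝ) (m : EuclideanSpace ℝ (Fin d)) :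
    Measure (EuclideanSpace ℝ (Fin d)) :=
  multivariateGaussian m (σ ^ 2 • (1 : Matrix (Fin d) (Fin d) ℝ))

/-! ### Gaussian projections, moments and anti-concentration. -/

lemma posSemidef_smul_one (d : ℕ) (σ : ℝ) :
    (σ ^ 2 • (1 : Matrix (Fin d) (Fin d) ℝ)).PosSemidef :=
  Matrix.PosSemidef.one.smul (sq_nonneg σ)

lemma covarianceBilin_gauss {d : ℕ} (σ : ℝ) (m a b : EuclideanSpace ℝ (Fin d)) :
    covarianceBilin (gauss σ m) a b = σ ^ 2 * ⟪a, b⟫ := by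
  rw [covarianceBilin_multivariateGaussian (posSemidef_smul_one d σ)]
  simp [Matrix.smul_mulVec, PiLp.inner_apply, dotProduct, mul_comm, mul_left_comm, Finset.mul_sum]

lemma integral_inner_gauss {d : ℕ} (σ : ℝ) (m a : EuclideanSpace ℝ (Fin d)) :
    ∫ x, ⟪a, x⟫ ∂(gauss σ m) = ⟪a, m⟫ := by
  have := ContinuousLinearMap.integral_comp_id_comm (μ := gauss σ m) IsGaussian.integrable_id
    (innerSL ℝ a)
  rw [integral_id_multivariateGaussian] at this
  simpa using this

lemma map_inner_gauss {d : ℕ} (σ : ℝ) (m a : EuclideanSpace ℝ (Fin d)) :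
    (gauss σ m).map (fun x => ⟪a, x⟫) = gaussianReal ⟪a, m⟫ (σ ^ 2 * ‖a‖ ^ 2).toNNReal := by
  have h := IsGaussian.map_eq_gaussianReal (μ := gauss σ m) (innerSL ℝ a)
  have h1 : (⇑(innerSL ℝ a) : EuclideanSpace ℝ (Fin d) → ℝ) = fun x => ⟪a, x⟫ := by
    ext x; simp
  rw [h1, integral_inner_gauss] at h
  rw [h]
  congr 2
  have h2 := covarianceBilin_apply_eq_cov (μ := gauss σ m) IsGaussian.memLp_two_id a a
  rw [covariance_self (by fun_prop), covarianceBilin_gauss, real_inner_self_eq_norm_sq] at h2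
  exact h2.symm

lemma indepFun_inner_gauss {d : ℕ} (σ : ℝ) (m : EuclideanSpace ℝ (Fin d))
    {a b : EuclideanSpace ℝ (Fin d)} (hab : ⟪a, b⟫ = (0 : ℝ)) :
    IndepFun (fun x : EuclideanSpace ℝ (Fin d) => ⟪a, x⟫) (fun x => ⟪b, x⟫) (gauss σ m) := by
  apply HasGaussianLaw.indepFun_of_covariance_eq_zero
  · have := (IsGaussian.hasGaussianLaw_id (μ := gauss σ m)).map_fun
      ((innerSL ℝ a).prod (innerSL ℝ b))
    simpa using this
  · have h2 := covarianceBilin_apply_eq_cov (μ := gauss σ m) IsGaussian.memLp_two_id a b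
    rw [← h2, covarianceBilin_gauss, hab, mul_zero]

lemma map_apply_gauss {d : ℕ} (σ : ℝ) (m : EuclideanSpace ℝ (Fin d)) (i : Fin d) :
    (gauss σ m).map (fun x => x i) = gaussianReal (m i) (σ ^ 2).toNNReal := by
  have := (measurePreserving_eval_multivariateGaussian (μ := m) (i := i)
    (posSemidef_smul_one d σ)).map_eq
  simpa using this

lemma indepFun_apply_gauss {d : ℕ} (σ : ℝ) (m : EuclideanSpace ℝ (Fin d))
    {i j : Fin d} (hij : i ≠ j) :
    IndepFun (fun x : EuclideanSpace ℝ (Fin d) => x i) (fun x => x j) (gauss σ m) := by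
  have := indepFun_inner_gauss σ m (a := EuclideanSpace.single i 1)
    (b := EuclideanSpace.single j 1) (by simp [EuclideanSpace.inner_single_left, hij])
  simpa [EuclideanSpace.inner_single_left] using this

/-- The first four moments of a real Gaussian. -/
lemma moments_gaussianReal (m : ℝ) (v : ℝ≥0) :
    ∫ x, x ^ 2 ∂(gaussianReal m v) = m ^ 2 + v ∧
    ∫ x, x ^ 4 ∂(gaussianReal m v) = m ^ 4 + 6 * m ^ 2 * v + 3 * v ^ 2 := by
  have hd (n : ℕ) : iteratedDeriv n (mgf id (gaussianReal m v)) 0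
      = ∫ x, x ^ n ∂(gaussianReal m v) := by
    rw [iteratedDeriv_mgf_zero]
    · rfl
    · rw [integrableExpSet_id_gaussianReal]; simp
  set F : ℝ → ℝ := fun t => rexp (m * t + v * t ^ 2 / 2) with hF
  have hFd (t : ℝ) : HasDerivAt F ((m + v * t) * F t) t := by
    have h1 : HasDerivAt (fun t : ℝ => m * t + v * t ^ 2 / 2) (m + v * t) t := by
      have := ((hasDerivAt_id' t).const_mul m).fun_add
        ((((hasDerivAt_id' t).fun_pow 2).const_mul (v : ℝ)).div_const 2)
      exact this.congr_deriv (by norm_num; ring)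
    have := h1.exp
    exact this.congr_deriv (by simp only [hF]; ring)
  have hl (t : ℝ) : HasDerivAt (fun t : ℝ => m + v * t) v t := by
    simpa using ((hasDerivAt_id' t).const_mul (v : ℝ)).const_add m
  -- Each derivative of the moment generating function is a polynomial in `m + v * t` times `F`; at
  -- `t = 0` the polynomial is the moment.
  have e1 : deriv F = fun t => (m + v * t) * F t := funext fun t => (hFd t).deriv
  have e2 : deriv (fun t => (m + v * t) * F t)
      = fun t => ((m + v * t) ^ 2 + v) * F t := by
    funext t
    rw [((hl t).fun_mul (hFd t)).deriv]; ring
  have e3 : deriv (fun t => ((m + v * t) ^ 2 + v) * F t)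
      = fun t => ((m + v * t) ^ 3 + 3 * v * (m + v * t)) * F t := by
    funext t
    rw [((((hl t).fun_pow 2).add_const (v : ℝ)).fun_mul (hFd t)).deriv]; norm_num; ring
  have e4 : deriv (fun t => ((m + v * t) ^ 3 + 3 * v * (m + v * t)) * F t)
      = fun t => ((m + v * t) ^ 4 + 6 * v * (m + v * t) ^ 2 + 3 * v ^ 2) * F t := by
    funext t
    rw [((((hl t).fun_pow 3).fun_add ((hl t).const_mul (3 * (v : ℝ)))).fun_mul (hFd t)).deriv]
    norm_num; ring
  constructor
  · rw [← hd 2, mgf_id_gaussianReal]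
    simp only [iteratedDeriv_succ, iteratedDeriv_zero]
    rw [← hF, e1, e2]; simp [hF]
  · rw [← hd 4, mgf_id_gaussianReal]
    simp only [iteratedDeriv_succ, iteratedDeriv_zero]
    rw [← hF, e1, e2, e3, e4]; simp [hF]; ring

lemma integrable_pow_gaussianReal (m : ℝ) (v : ℝ≥0) (k : ℕ) :
    Integrable (fun x : ℝ => x ^ k) (gaussianReal m v) := by
  have := (memLp_id_gaussianReal (μ := m) (v := v) (k : ℝ≥0)).integrable_norm_pow'
  refine (integrable_norm_iff (by fun_prop)).1 ?_
  simpa using this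

lemma gaussianReal_le_of_pdf_le {m : ℝ} {v : ℝ≥0} (hv : v ≠ 0) {A : Set ℝ}
    {K : ℝ} (hK : ∀ x ∈ A, gaussianPDFReal m v x ≤ K) :
    gaussianReal m v A ≤ ENNReal.ofReal K * volume A := by
  rw [gaussianReal_apply m hv]
  calc ∫⁻ x in A, gaussianPDF m v x ≤ ∫⁻ _ in A, ENNReal.ofReal K :=
        setLIntegral_mono measurable_const fun x hx => ENNReal.ofReal_le_ofReal (hK x hx)
    _ = _ := by simp

lemma gaussianPDFReal_le_inv {m σ : ℝ} (hσ : 0 < σ) (x : ℝ) :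
    gaussianPDFReal m (σ ^ 2).toNNReal x ≤ 1 / (2 * σ) := by
  rw [gaussianPDFReal, Real.coe_toNNReal _ (sq_nonneg σ)]
  have h2 : 2 * σ ≤ √(2 * π * σ ^ 2) := by
    apply Real.le_sqrt_of_sq_le
    nlinarith [Real.pi_gt_three, sq_pos_of_pos hσ]
  have h3 : rexp (-(x - m) ^ 2 / (2 * σ ^ 2)) ≤ 1 := by
    apply Real.exp_le_one_iff.2
    apply div_nonpos_of_nonpos_of_nonneg <;> nlinarith [sq_nonneg (x - m), sq_nonneg σ]
  rw [one_div]
  calc _ ≤ (2 * σ)⁻¹ * 1 := by gcongr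
    _ = _ := by ring

/-- With `t = δ / σ`, `exp (t² / 2) ≥ 1 + t² / 2 ≥ t`. Far from the mean this trades the factor `1 /
σ` for `1 / δ`. -/
lemma gaussianPDFReal_le_inv_dist {m σ δ : ℝ} (hσ : 0 < σ) (hδ : 0 < δ) {x : ℝ}
    (hx : δ ≤ |x - m|) :
    gaussianPDFReal m (σ ^ 2).toNNReal x ≤ 1 / (2 * δ) := by
  rw [gaussianPDFReal, Real.coe_toNNReal _ (sq_nonneg σ)]
  have h2 : 2 * σ ≤ √(2 * π * σ ^ 2) := by
    apply Real.le_sqrt_of_sq_le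
    nlinarith [Real.pi_gt_three, sq_pos_of_pos hσ]
  have hsq : δ ^ 2 ≤ (x - m) ^ 2 := by
    rw [← sq_abs (x - m)]; gcongr
  have h3 : rexp (-(x - m) ^ 2 / (2 * σ ^ 2)) ≤ σ / δ := by
    have h4 : δ / σ ≤ rexp ((x - m) ^ 2 / (2 * σ ^ 2)) := by
      have h5 := Real.add_one_le_exp ((x - m) ^ 2 / (2 * σ ^ 2))
      have h6 : δ ^ 2 / (2 * σ ^ 2) ≤ (x - m) ^ 2 / (2 * σ ^ 2) := by gcongr
      have h7 : δ ^ 2 / (2 * σ ^ 2) = (δ / σ) ^ 2 / 2 := by field_simp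
      nlinarith [sq_nonneg (δ / σ - 1)]
    rw [neg_div, Real.exp_neg, ← inv_div δ σ]
    exact inv_anti₀ (by positivity) h4
  calc _ ≤ (2 * σ)⁻¹ * (σ / δ) := by gcongr
    _ = _ := by field_simp

/-- Gaussian anti-concentration in an interval of half-width `a + h` around the origin. -/
lemma gaussianReal_abs_le {m σ a h : ℝ} (hσ : 0 < σ) (ha : 0 ≤ a) (hh : 0 ≤ h) :
    gaussianReal m (σ ^ 2).toNNReal {x | |x| ≤ a + h} ≤
      ENNReal.ofReal (a / σ + 2 * h / max |m| σ) := by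
  have hv : (σ ^ 2).toNNReal ≠ 0 := by
    rw [Ne, Real.toNNReal_eq_zero]; nlinarith [sq_pos_of_pos hσ]
  -- Only the core `[-h, h]` benefits from a distant mean. The two side pieces of length `a` cost `a
  -- / (2 * σ)` each.
  have hsub : {x : ℝ | |x| ≤ a + h} ⊆
      Set.Icc (-h) h ∪ (Set.Icc (-(a + h)) (-h) ∪ Set.Icc h (a + h)) := by
    intro x hx
    simp only [Set.mem_ofPred_eq, abs_le] at hx
    simp only [Set.mem_union, Set.mem_Icc]
    grind
  have h1 : gaussianReal m (σ ^ 2).toNNReal (Set.Icc (-h) h) ≤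
      ENNReal.ofReal (2 * h / max |m| σ) := by
    rcases le_total |m| σ with hm | hm
    · rw [max_eq_right hm]
      refine (gaussianReal_le_of_pdf_le hv
        (fun x _ => gaussianPDFReal_le_inv hσ x)).trans ?_
      rw [Real.volume_Icc, ← ENNReal.ofReal_mul (by positivity)]
      apply ENNReal.ofReal_le_ofReal
      rw [div_mul_eq_mul_div, div_le_div_iff₀ (by positivity) hσ]
      nlinarith [mul_nonneg hh hσ.le]
    · rw [max_eq_left hm]
      have hm0 : 0 < |m| := hσ.trans_le hm
      -- Either the core stays at distance `|m| / 2` from the mean, so the density there is at most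
      -- `1 / |m|`, or the claimed bound is at least 1.
      rcases le_total h (|m| / 2) with hc | hc
      · refine (gaussianReal_le_of_pdf_le hv
          (K := 1 / (2 * (|m| / 2))) (fun x hx => gaussianPDFReal_le_inv_dist hσ (by positivity) ?_)).trans ?_
        · have hxa : |x| ≤ h := abs_le.2 hx
          have := abs_sub_abs_le_abs_sub m x
          rw [abs_sub_comm m x] at this
          linarith
        · rw [Real.volume_Icc, ← ENNReal.ofReal_mul (by positivity)]
          apply ENNReal.ofReal_le_ofReal
          apply le_of_eq
          field_simp
          ring
      · refine prob_le_one.trans ?_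
        rw [← ENNReal.ofReal_one]
        apply ENNReal.ofReal_le_ofReal
        rw [le_div_iff₀ hm0]; linarith
  have h2 (p q : ℝ) (hpq : q - p = a) : gaussianReal m (σ ^ 2).toNNReal (Set.Icc p q) ≤
      ENNReal.ofReal (a / (2 * σ)) := by
    refine (gaussianReal_le_of_pdf_le hv
        (fun x _ => gaussianPDFReal_le_inv hσ x)).trans ?_
    rw [Real.volume_Icc, ← ENNReal.ofReal_mul (by positivity), hpq]
    apply le_of_eq; congr 1; ring
  calc _ ≤ _ := measure_mono hsub
    _ ≤ _ := (measure_union_le _ _).trans (add_le_add le_rfl (measure_union_le _ _))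
    _ ≤ ENNReal.ofReal (2 * h / max |m| σ) + (ENNReal.ofReal (a / (2 * σ)) +
          ENNReal.ofReal (a / (2 * σ))) := by
        gcongr
        · exact h2 _ _ (by ring)
        · exact h2 _ _ (by ring)
    _ = _ := by
        rw [← ENNReal.ofReal_add (by positivity) (by positivity),
          ← ENNReal.ofReal_add (by positivity) (by positivity)]
        congr 1; ring

/-- Follows from `|x| ≤ x² / (2 τ) + τ / 2` and the second moment. -/
lemma lintegral_abs_gaussianReal_le {τ : ℝ} (hτ : 0 ≤ τ) :
    ∫⁻ x, ENNReal.ofReal |x| ∂(gaussianReal 0 (τ ^ 2).toNNReal) ≤ ENNReal.ofReal τ := by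
  rcases hτ.eq_or_lt with rfl | hτ
  · simp [gaussianReal_zero_var]
  have h2 := (moments_gaussianReal 0 (τ ^ 2).toNNReal).1
  rw [Real.coe_toNNReal _ (sq_nonneg τ)] at h2
  have hi := integrable_pow_gaussianReal 0 (τ ^ 2).toNNReal 2
  calc _ ≤ ∫⁻ x, ENNReal.ofReal (x ^ 2 / (2 * τ) + τ / 2) ∂(gaussianReal 0 (τ ^ 2).toNNReal) := by
        apply lintegral_mono; intro x
        apply ENNReal.ofReal_le_ofReal
        rw [div_add_div _ _ (by positivity) (by positivity), le_div_iff₀ (by positivity)]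
        nlinarith [sq_nonneg (|x| - τ), sq_abs x]
    _ = ENNReal.ofReal (∫ x, (x ^ 2 / (2 * τ) + τ / 2) ∂(gaussianReal 0 (τ ^ 2).toNNReal)) := by
        rw [ofReal_integral_eq_lintegral_ofReal]
        · exact (hi.div_const _).add (integrable_const _)
        · exact Filter.Eventually.of_forall fun x => by positivity
    _ = _ := by
        rw [integral_add (hi.div_const _) (integrable_const _), integral_div, h2]
        congr 1
        simp; field_simp; norm_num

/-- The Gaussian mass of a double cone around the hyperplane `⟪u, x⟫ = p`. -/
lemma gauss_cone_le {d : ℕ} {σ : ℝ} (hσ : 0 < σ) (m : EuclideanSpace ℝ (Fin d))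
    {u w : EuclideanSpace ℝ (Fin d)} (hu : ‖u‖ = 1) (huw : ⟪u, w⟫ = (0 : ℝ))
    (p q : ℝ) (hq : ⟪w, m⟫ = q) {k h : ℝ} (hk : 0 ≤ k) (hh : 0 ≤ h) :
    gauss σ m {x | |⟪u, x⟫ - p| ≤ k * |⟪w, x⟫ - q| + h} ≤
      ENNReal.ofReal (k * ‖w‖ + 2 * h / max |⟪u, m⟫ - p| σ) := by
  set μ₁ := gaussianReal (⟪u, m⟫ - p) (σ ^ 2).toNNReal
  set μ₂ := gaussianReal 0 ((σ * ‖w‖) ^ 2).toNNReal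
  have e1 : (gauss σ m).map (fun x => ⟪u, x⟫ - p) = μ₁ := by
    have := gaussianReal_map_sub_const (μ := ⟪u, m⟫) (v := (σ ^ 2 * ‖u‖ ^ 2).toNNReal) p
    rw [← map_inner_gauss, Measure.map_map (by fun_prop) (by fun_prop), hu] at this
    simpa [Function.comp_def] using this
  have e2 : (gauss σ m).map (fun x => ⟪w, x⟫ - q) = μ₂ := by
    have := gaussianReal_map_sub_const (μ := ⟪w, m⟫) (v := (σ ^ 2 * ‖w‖ ^ 2).toNNReal) q
    rw [← map_inner_gauss, Measure.map_map (by fun_prop) (by fun_prop), hq, sub_self,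
      ← mul_pow] at this
    simpa [Function.comp_def] using this
  have hind : IndepFun (fun x : EuclideanSpace ℝ (Fin d) => ⟪w, x⟫ - q)
      (fun x => ⟪u, x⟫ - p) (gauss σ m) :=
    (indepFun_inner_gauss σ m (by rwa [real_inner_comm])).comp
      (φ := fun t : ℝ => t - q) (ψ := fun t : ℝ => t - p) (by fun_prop) (by fun_prop)
  have hprod := (indepFun_iff_map_prod_eq_prod_map_map (by fun_prop) (by fun_prop)).1 hind
  rw [e1, e2] at hprod
  -- By independence the cone can be sliced: for a fixed value `z` across the hyperplane normal, the
  -- slice is an interval of half-width `k * |z| + h`, and `E |z| ≤ σ * ‖w‖`.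
  have hms : MeasurableSet {z : ℝ × ℝ | |z.2| ≤ k * |z.1| + h} :=
    measurableSet_le (by fun_prop) (by fun_prop)
  have : gauss σ m {x | |⟪u, x⟫ - p| ≤ k * |⟪w, x⟫ - q| + h}
      = (μ₂.prod μ₁) {z : ℝ × ℝ | |z.2| ≤ k * |z.1| + h} := by
    rw [← hprod, Measure.map_apply (by fun_prop) hms]
    rfl
  rw [this, Measure.prod_apply hms]
  calc _ ≤ ∫⁻ z, (ENNReal.ofReal (k / σ) * ENNReal.ofReal |z| +
          ENNReal.ofReal (2 * h / max |⟪u, m⟫ - p| σ)) ∂μ₂ := by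
        apply lintegral_mono; intro z
        refine (gaussianReal_abs_le (m := ⟪u, m⟫ - p) (a := k * |z|) hσ (by positivity) hh).trans ?_
        beta_reduce
        rw [← ENNReal.ofReal_mul (by positivity), ← ENNReal.ofReal_add (by positivity)
          (by positivity)]
        apply le_of_eq; congr 1; ring
    _ = ENNReal.ofReal (k / σ) * ∫⁻ z, ENNReal.ofReal |z| ∂μ₂ +
          ENNReal.ofReal (2 * h / max |⟪u, m⟫ - p| σ) := by
        rw [lintegral_add_right _ measurable_const, lintegral_const_mul _ (by fun_prop)]
        simp [μ₂]
    _ ≤ ENNReal.ofReal (k / σ) * ENNReal.ofReal (σ * ‖w‖) +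
          ENNReal.ofReal (2 * h / max |⟪u, m⟫ - p| σ) := by
        gcongr
        exact lintegral_abs_gaussianReal_le (by positivity)
    _ = _ := by
        rw [← ENNReal.ofReal_mul (by positivity), ← ENNReal.ofReal_add (by positivity)
          (by positivity)]
        congr 1; field_simp

/-! ### Exponential and second-moment bounds for i.i.d. sums. -/

section Iid

variable {Ω : Type*} [MeasurableSpace Ω] (P : Measure Ω) [IsProbabilityMeasure P]

/-- Chernoff bound for an i.i.d. sample. -/
lemma pi_sum_nonneg_le (n : ℕ) {f : Ω → ℝ} {c : ℝ} (hf : Integrable (fun x => rexp (f x)) P)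
    (hc : ∫ x, rexp (f x) ∂P ≤ rexp (-c)) :
    (Measure.pi fun _ : Fin n => P) {X | 0 ≤ ∑ k, f (X k)} ≤ ENNReal.ofReal (rexp (-(n * c))) := by
  have hint : Integrable (fun X : Fin n → Ω => ∏ k, rexp (f (X k)))
      (Measure.pi fun _ : Fin n => P) := Integrable.fintype_prod fun _ => hf
  calc _ ≤ (Measure.pi fun _ : Fin n => P)
        {X | 1 ≤ ENNReal.ofReal (∏ k, rexp (f (X k)))} := by
        apply measure_mono
        intro X hX
        simp only [Set.mem_ofPred_eq] at hX ⊢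
        rw [← Real.exp_sum, ENNReal.one_le_ofReal]
        exact Real.one_le_exp hX
    _ ≤ ∫⁻ X, ENNReal.ofReal (∏ k, rexp (f (X k))) ∂(Measure.pi fun _ : Fin n => P) := by
        have := mul_meas_ge_le_lintegral₀ (μ := Measure.pi fun _ : Fin n => P)
          (f := fun X => ENNReal.ofReal (∏ k, rexp (f (X k))))
          hint.aestronglyMeasurable.aemeasurable.ennreal_ofReal 1
        simpa using this
    _ = ENNReal.ofReal (∫ X, ∏ k, rexp (f (X k)) ∂(Measure.pi fun _ : Fin n => P)) := by
        rw [ofReal_integral_eq_lintegral_ofReal hint]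
        exact Filter.Eventually.of_forall fun X => by positivity
    _ ≤ _ := by
        apply ENNReal.ofReal_le_ofReal
        have := integral_fintype_prod_eq_pow (ι := Fin n) (μ := P) (fun x => rexp (f x))
        rw [this, Fintype.card_fin]
        calc _ ≤ rexp (-c) ^ n := pow_le_pow_left₀ (integral_nonneg fun x => by positivity) hc n
          _ = _ := by rw [← Real.exp_nat_mul]; ring_nf

/-- The mean square of a centred empirical mean. -/
lemma integral_sq_empiricalMean (n : ℕ) (hn : n ≠ 0) {f : Ω → ℝ} (hf : MemLp f 2 P)
    (hf0 : ∫ x, f x ∂P = 0) :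
    Integrable (fun X : Fin n → Ω => ((n : ℝ)⁻¹ * ∑ k, f (X k)) ^ 2)
      (Measure.pi fun _ : Fin n => P) ∧
    ∫ X, ((n : ℝ)⁻¹ * ∑ k, f (X k)) ^ 2 ∂(Measure.pi fun _ : Fin n => P)
      = (n : ℝ)⁻¹ * ∫ x, f x ^ 2 ∂P := by
  have hk (k : Fin n) : MemLp (fun X : Fin n → Ω => f (X k)) 2 (Measure.pi fun _ : Fin n => P) :=
    hf.comp_measurePreserving (measurePreserving_eval _ k)
  have hsum : MemLp (fun X : Fin n → Ω => ∑ k, f (X k)) 2 (Measure.pi fun _ : Fin n => P) :=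
    memLp_finsetSum _ fun k _ => hk k
  have hmean : ∫ X, ∑ k, f (X k) ∂(Measure.pi fun _ : Fin n => P) = 0 := by
    rw [integral_finsetSum _ fun k _ => (hk k).integrable (by norm_num)]
    apply Finset.sum_eq_zero
    intro k _
    rw [← hf0]
    exact integral_comp_eval (μ := fun _ : Fin n => P) hf.aestronglyMeasurable
  have hvar := variance_sum_pi (μ := fun _ : Fin n => P) (X := fun _ => f) (fun _ => hf)
  have e1 : (∑ i, fun ω : Fin n → Ω => f (ω i)) = fun X => ∑ k, f (X k) := by
    ext X; simp
  rw [e1, variance_of_integral_eq_zero hsum.aemeasurable hmean] at hvar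
  simp only [variance_of_integral_eq_zero hf.aemeasurable hf0] at hvar
  simp only [mul_pow]
  refine ⟨hsum.integrable_sq.const_mul _, ?_⟩
  rw [integral_const_mul, hvar]
  simp
  field_simp

end Iid

/-! ### One coordinate of the mixture and its exponential moments. -/

instance {d : ℕ} (σ : ℝ) (θ : EuclideanSpace ℝ (Fin d) × EuclideanSpace ℝ (Fin d)) :
    IsProbabilityMeasure (mixture σ θ) := ⟨by
  simp [mixture, ENNReal.inv_two_add_inv_two]⟩

/-- The centre of the two means. -/
noncomputable def center {d : ℕ} (θ : EuclideanSpace ℝ (Fin d) × EuclideanSpace ℝ (Fin d)) :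
    EuclideanSpace ℝ (Fin d) := (2⁻¹ : ℝ) • (θ.1 + θ.2)

/-- Half the difference of the two means. -/
noncomputable def halfDiff {d : ℕ} (θ : EuclideanSpace ℝ (Fin d) × EuclideanSpace ℝ (Fin d)) :
    EuclideanSpace ℝ (Fin d) := (2⁻¹ : ℝ) • (θ.1 - θ.2)

/-- The symmetric two-component mixture on the line. -/
noncomputable def symmMix (m σ : ℝ) : Measure ℝ :=
  (2⁻¹ : ENNReal) • gaussianReal m (σ ^ 2).toNNReal +
    (2⁻¹ : ENNReal) • gaussianReal (-m) (σ ^ 2).toNNReal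

instance (m σ : ℝ) : IsProbabilityMeasure (symmMix m σ) := ⟨by
  simp [symmMix, ENNReal.inv_two_add_inv_two]⟩

lemma map_coord_mixture {d : ℕ} (σ : ℝ)
    (θ : EuclideanSpace ℝ (Fin d) × EuclideanSpace ℝ (Fin d)) (i : Fin d) :
    (mixture σ θ).map (fun x => x i - center θ i) = symmMix (halfDiff θ i) σ := by
  have h (m : EuclideanSpace ℝ (Fin d)) : (gauss σ m).map (fun x => x i - center θ i)
      = gaussianReal (m i - center θ i) (σ ^ 2).toNNReal := by
    have := gaussianReal_map_sub_const (μ := m i) (v := (σ ^ 2).toNNReal) (center θ i)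
    rw [← map_apply_gauss, Measure.map_map (by fun_prop) (by fun_prop)] at this
    simpa [Function.comp_def] using this
  rw [mixture, Measure.map_add _ _ (by fun_prop), Measure.map_smul, Measure.map_smul, symmMix]
  rw [h, h]
  congr 3 <;> simp [center, halfDiff] <;> ring

lemma integrable_symmMix {m σ : ℝ} {f : ℝ → ℝ}
    (h : ∀ m', Integrable f (gaussianReal m' (σ ^ 2).toNNReal)) :
    Integrable f (symmMix m σ) :=
  ((h m).smul_measure (by simp)).add_measure ((h (-m)).smul_measure (by simp))

lemma integral_symmMix {m σ : ℝ} {f : ℝ → ℝ}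
    (h : ∀ m', Integrable f (gaussianReal m' (σ ^ 2).toNNReal)) :
    ∫ x, f x ∂(symmMix m σ) = 2⁻¹ * ∫ x, f x ∂(gaussianReal m (σ ^ 2).toNNReal) +
      2⁻¹ * ∫ x, f x ∂(gaussianReal (-m) (σ ^ 2).toNNReal) := by
  rw [symmMix, integral_add_measure ((h m).smul_measure (by simp))
    ((h (-m)).smul_measure (by simp)), integral_smul_measure, integral_smul_measure]
  simp

lemma integral_sq_symmMix (m σ : ℝ) : ∫ x, x ^ 2 ∂(symmMix m σ) = m ^ 2 + σ ^ 2 := by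
  rw [integral_symmMix fun m' => integrable_pow_gaussianReal _ _ _,
    (moments_gaussianReal _ _).1, (moments_gaussianReal _ _).1, Real.coe_toNNReal _ (sq_nonneg σ)]
  ring

lemma integral_pow_four_symmMix_le (m σ : ℝ) :
    ∫ x, x ^ 4 ∂(symmMix m σ) ≤ 3 * (m ^ 2 + σ ^ 2) ^ 2 := by
  rw [integral_symmMix fun m' => integrable_pow_gaussianReal _ _ _,
    (moments_gaussianReal _ _).2, (moments_gaussianReal _ _).2, Real.coe_toNNReal _ (sq_nonneg σ)]
  nlinarith [sq_nonneg (m ^ 2)]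

/-- The two signs of `m` average to `cosh (m * s) ≤ exp ((m * s)² / 2)`, so the mixture is
sub-Gaussian with its own variance as proxy. -/
lemma integral_exp_mul_symmMix (m σ s : ℝ) :
    Integrable (fun x => rexp (s * x)) (symmMix m σ) ∧
    ∫ x, rexp (s * x) ∂(symmMix m σ) ≤ rexp (s ^ 2 * (m ^ 2 + σ ^ 2) / 2) := by
  have hi (m' : ℝ) : Integrable (fun x => rexp (s * x)) (gaussianReal m' (σ ^ 2).toNNReal) :=
    integrable_exp_mul_gaussianReal s
  refine ⟨integrable_symmMix hi, ?_⟩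
  have he (m' : ℝ) : ∫ x, rexp (s * x) ∂(gaussianReal m' (σ ^ 2).toNNReal)
      = rexp (m' * s + σ ^ 2 * s ^ 2 / 2) := by
    have := congrFun (mgf_id_gaussianReal (μ := m') (v := (σ ^ 2).toNNReal)) s
    rw [Real.coe_toNNReal _ (sq_nonneg σ)] at this
    exact this
  rw [integral_symmMix hi, he, he]
  calc _ = Real.cosh (m * s) * rexp (σ ^ 2 * s ^ 2 / 2) := by
        rw [Real.cosh_eq, Real.exp_add, Real.exp_add]; ring_nf
    _ ≤ rexp ((m * s) ^ 2 / 2) * rexp (σ ^ 2 * s ^ 2 / 2) := by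
        gcongr
        exact Real.cosh_le_exp_half_sq _
    _ = _ := by rw [← Real.exp_add]; ring_nf

lemma integral_exp_sq_gaussianReal {m σ t : ℝ} (hσ : 0 < σ) (ht : 2 * t * σ ^ 2 < 1) :
    Integrable (fun x => rexp (t * x ^ 2)) (gaussianReal m (σ ^ 2).toNNReal) ∧
    ∫ x, rexp (t * x ^ 2) ∂(gaussianReal m (σ ^ 2).toNNReal) =
      (√(1 - 2 * t * σ ^ 2))⁻¹ * rexp (t * m ^ 2 / (1 - 2 * t * σ ^ 2)) := by
  have hv : (σ ^ 2).toNNReal ≠ 0 := by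
    rw [Ne, Real.toNNReal_eq_zero]; nlinarith [sq_pos_of_pos hσ]
  set D := 1 - 2 * t * σ ^ 2 with hD
  have hD0 : 0 < D := by rw [hD]; linarith
  set b := D / (2 * σ ^ 2) with hb
  have hb0 : 0 < b := by positivity
  set A := (√(2 * π * σ ^ 2))⁻¹ * rexp (t * m ^ 2 / D) with hA
  -- Completing the square: the tilted density is again Gaussian, centred at `m / D` with variance
  -- `σ² / D`.
  have key (x : ℝ) : gaussianPDFReal m (σ ^ 2).toNNReal x * rexp (t * x ^ 2) =
      A * rexp (-b * (x - m / D) ^ 2) := by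
    rw [gaussianPDFReal, Real.coe_toNNReal _ (sq_nonneg σ), hA, mul_assoc _ (rexp _) (rexp _),
      mul_assoc _ (rexp _) (rexp _),
      ← Real.exp_add, ← Real.exp_add]
    congr 2
    rw [hb]
    field_simp
    rw [hD]; ring
  have hint : Integrable (fun x => A * rexp (-b * (x - m / D) ^ 2)) :=
    ((integrable_exp_neg_mul_sq hb0).comp_sub_right (m / D)).const_mul A
  constructor
  · rw [gaussianReal_of_var_ne_zero _ hv, integrable_withDensity_iff_integrable_smul']
    · simp only [toReal_gaussianPDF, smul_eq_mul, key]
      exact hint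
    · exact measurable_gaussianPDF _ _
    · exact Filter.Eventually.of_forall fun x => gaussianPDF_lt_top
  · rw [integral_gaussianReal_eq_integral_smul hv]
    simp only [smul_eq_mul, key]
    rw [integral_const_mul, integral_sub_right_eq_self (fun x => rexp (-b * x ^ 2)),
      integral_gaussian, hA, hb]
    have : √(π / (D / (2 * σ ^ 2))) = √(2 * π * σ ^ 2) * (√D)⁻¹ := by
      rw [← Real.sqrt_inv, ← Real.sqrt_mul (by positivity)]
      congr 1; field_simp
    rw [this]
    field_simp

/-- The bound is the value for a centred Gaussian of the same variance `m² + σ²`. The comparison is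
`exp (y / 2) ≤ 1 / √(1 - y)`, where `D * (1 - y) = 1 - 2 t (m² + σ²)`. -/
lemma integral_exp_sq_symmMix_le {m σ t : ℝ} (hσ : 0 < σ) (ht0 : 0 ≤ t)
    (ht : 2 * t * (m ^ 2 + σ ^ 2) < 1) :
    Integrable (fun x => rexp (t * x ^ 2)) (symmMix m σ) ∧
    ∫ x, rexp (t * x ^ 2) ∂(symmMix m σ) ≤ (√(1 - 2 * t * (m ^ 2 + σ ^ 2)))⁻¹ := by
  have ht' : 2 * t * σ ^ 2 < 1 := by nlinarith [mul_nonneg ht0 (sq_nonneg m)]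
  have hi (m' : ℝ) := (integral_exp_sq_gaussianReal (m := m') hσ ht').1
  refine ⟨integrable_symmMix hi, ?_⟩
  rw [integral_symmMix hi, (integral_exp_sq_gaussianReal hσ ht').2,
    (integral_exp_sq_gaussianReal hσ ht').2, neg_sq]
  set D := 1 - 2 * t * σ ^ 2 with hD
  have hD0 : 0 < D := by rw [hD]; linarith
  set y := 2 * t * m ^ 2 / D with hy
  have hy1 : y < 1 := by
    rw [hy, div_lt_one hD0, hD]; linarith
  have e : 1 - 2 * t * (m ^ 2 + σ ^ 2) = D * (1 - y) := by
    rw [hy]; field_simp; rw [hD]; ring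
  have h1 : t * m ^ 2 / D = y / 2 := by rw [hy]; ring
  have h2 : rexp (y / 2) ≤ (√(1 - y))⁻¹ := by
    have h3 : √(1 - y) ≤ rexp (-(y / 2)) := by
      rw [Real.sqrt_le_left (by positivity), ← Real.exp_nat_mul]
      have := Real.add_one_le_exp (-y)
      calc _ ≤ _ := by linarith
        _ ≤ rexp (-y) := this
        _ = _ := by congr 1; push_cast; ring
    have h4 : 0 < √(1 - y) := Real.sqrt_pos.2 (by linarith)
    rw [le_inv_comm₀ (by positivity) h4, ← Real.exp_neg]
    exact h3
  rw [e, Real.sqrt_mul hD0.le, mul_inv, h1]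
  have : 0 ≤ (√D)⁻¹ := by positivity
  nlinarith [mul_le_mul_of_nonneg_left h2 this]

/-- For lower tails two moments of `x²` suffice: `exp (-y) ≤ 1 - y + y² / 2`, and the fourth moment
is at most three times the squared variance. -/
lemma integral_exp_neg_sq_symmMix_le {m σ t : ℝ} (ht0 : 0 ≤ t) :
    Integrable (fun x => rexp (-(t * x ^ 2))) (symmMix m σ) ∧
    ∫ x, rexp (-(t * x ^ 2)) ∂(symmMix m σ) ≤
      rexp (-(t * (m ^ 2 + σ ^ 2)) + 3 / 2 * (t * (m ^ 2 + σ ^ 2)) ^ 2) := by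
  have hi : Integrable (fun x => rexp (-(t * x ^ 2))) (symmMix m σ) := by
    refine Integrable.mono' (integrable_const (1 : ℝ)) (by fun_prop) ?_
    refine Filter.Eventually.of_forall fun x => ?_
    rw [Real.norm_eq_abs, abs_of_pos (Real.exp_pos _), Real.exp_le_one_iff]
    have : 0 ≤ t * x ^ 2 := by positivity
    linarith
  refine ⟨hi, ?_⟩
  have i2 : Integrable (fun x : ℝ => x ^ 2) (symmMix m σ) :=
    integrable_symmMix fun m' => integrable_pow_gaussianReal _ _ _
  have i4 : Integrable (fun x : ℝ => x ^ 4) (symmMix m σ) :=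
    integrable_symmMix fun m' => integrable_pow_gaussianReal _ _ _
  have hexp (y : ℝ) (hy : 0 ≤ y) : rexp (-y) ≤ 1 - y + y ^ 2 / 2 := by
    have h1 : 1 + y + y ^ 2 / 2 ≤ rexp y := Real.quadratic_le_exp_of_nonneg hy
    rw [Real.exp_neg, inv_le_comm₀ (by positivity) (by nlinarith [sq_nonneg (y - 1)])]
    refine le_trans ?_ h1
    rw [inv_le_iff_one_le_mul₀ (by nlinarith [sq_nonneg (y - 1)])]
    nlinarith [sq_nonneg (y ^ 2)]
  have i1 : Integrable (fun x : ℝ => 1 - t * x ^ 2) (symmMix m σ) :=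
    (integrable_const _).sub (i2.const_mul t)
  calc _ ≤ ∫ x, (1 - t * x ^ 2 + t ^ 2 / 2 * x ^ 4) ∂(symmMix m σ) := by
        refine integral_mono hi (i1.add (i4.const_mul _)) fun x => ?_
        refine (hexp (t * x ^ 2) (by positivity)).trans (le_of_eq ?_)
        ring
    _ = 1 - t * (m ^ 2 + σ ^ 2) + t ^ 2 / 2 * ∫ x, x ^ 4 ∂(symmMix m σ) := by
        rw [integral_add i1 (i4.const_mul _),
          integral_sub (integrable_const _) (i2.const_mul t), integral_const_mul,
          integral_const_mul, integral_sq_symmMix]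
        simp
    _ ≤ 1 - t * (m ^ 2 + σ ^ 2) + t ^ 2 / 2 * (3 * (m ^ 2 + σ ^ 2) ^ 2) := by
        gcongr
        exact integral_pow_four_symmMix_le m σ
    _ = (-(t * (m ^ 2 + σ ^ 2)) + 3 / 2 * (t * (m ^ 2 + σ ^ 2)) ^ 2) + 1 := by ring
    _ ≤ _ := Real.add_one_le_exp _

/-! ### Concentration of the sample variances. -/

lemma sampleMean_apply {d n : ℕ} (X : Fin n → EuclideanSpace ℝ (Fin d)) (i : Fin d) :
    sampleMean X i = (n : ℝ)⁻¹ * ∑ k, X k i := by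
  simp [sampleMean]

lemma sampleMean_sub_apply {d n : ℕ} (hn : n ≠ 0) (X : Fin n → EuclideanSpace ℝ (Fin d))
    (c : EuclideanSpace ℝ (Fin d)) (i : Fin d) :
    sampleMean X i - c i = (n : ℝ)⁻¹ * ∑ k, (X k i - c i) := by
  have : (n : ℝ) ≠ 0 := by exact_mod_cast hn
  rw [sampleMean_apply, Finset.sum_sub_distrib]
  simp
  field_simp

/-- The sample covariance through deviations from an arbitrary centre. -/
lemma sampleCov_eq {d n : ℕ} (hn : n ≠ 0) (X : Fin n → EuclideanSpace ℝ (Fin d))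
    (c : EuclideanSpace ℝ (Fin d)) (i j : Fin d) :
    sampleCov X i j = (n : ℝ)⁻¹ * ∑ k, (X k i - c i) * (X k j - c j) -
      (sampleMean X i - c i) * (sampleMean X j - c j) := by
  have hn' : (n : ℝ) ≠ 0 := by exact_mod_cast hn
  have hi := sampleMean_sub_apply hn X c i
  have hj := sampleMean_sub_apply hn X c j
  set a := sampleMean X i - c i with ha
  set b := sampleMean X j - c j with hb
  have ei : ∑ k, (X k i - c i) = n * a := by rw [hi]; field_simp
  have ej : ∑ k, (X k j - c j) = n * b := by rw [hj]; field_simp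
  have key : ∑ k, (X k i - sampleMean X i) * (X k j - sampleMean X j) =
      ∑ k, (X k i - c i) * (X k j - c j) - n * (a * b) := by
    have : ∀ k, (X k i - sampleMean X i) * (X k j - sampleMean X j) =
        (X k i - c i) * (X k j - c j) - b * (X k i - c i) - a * (X k j - c j) + a * b := by
      intro k; rw [ha, hb]; ring
    simp only [this, Finset.sum_add_distrib, Finset.sum_sub_distrib, ← Finset.mul_sum] at ei ej ⊢
    rw [ei, ej]
    simp
    ring
  simp only [sampleCov, Matrix.of_apply]
  rw [key]
  field_simp

lemma sampleLaw_coord_le {d : ℕ} (n : ℕ) (σ : ℝ)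
    (θ : EuclideanSpace ℝ (Fin d) × EuclideanSpace ℝ (Fin d)) (i : Fin d) {g : ℝ → ℝ} {c : ℝ}
    (hg : Integrable (fun y => rexp (g y)) (symmMix (halfDiff θ i) σ))
    (hc : ∫ y, rexp (g y) ∂(symmMix (halfDiff θ i) σ) ≤ rexp (-c)) :
    sampleLaw σ n θ {X | 0 ≤ ∑ k, g (X k i - center θ i)} ≤ ENNReal.ofReal (rexp (-(n * c))) := by
  rw [← map_coord_mixture] at hg hc
  rw [integral_map (by fun_prop) hg.aestronglyMeasurable] at hc
  exact pi_sum_nonneg_le (mixture σ θ) n (f := fun x => g (x i - center θ i))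
    (hg.comp_measurable (by fun_prop)) hc

lemma sum_sq_upper_tail {d : ℕ} (n : ℕ) {σ a : ℝ} (hσ : 0 < σ) (ha : 0 ≤ a)
    (θ : EuclideanSpace ℝ (Fin d) × EuclideanSpace ℝ (Fin d)) (i : Fin d) :
    sampleLaw σ n θ {X | n * ((1 + (√6 * a + 2 * a ^ 2)) * (halfDiff θ i ^ 2 + σ ^ 2)) ≤
      ∑ k, (X k i - center θ i) ^ 2} ≤ ENNReal.ofReal (rexp (-(n * a ^ 2))) := by
  set V := halfDiff θ i ^ 2 + σ ^ 2 with hV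
  have hV0 : 0 < V := by positivity
  -- The Laurent–Massart exponent for chi-square tails; it makes `1 - 2 t V = 1 / (1 + 2 a)`.
  set t := a / ((1 + 2 * a) * V) with ht
  have ht0 : 0 ≤ t := by positivity
  have htV : t * V = a / (1 + 2 * a) := by rw [ht]; field_simp
  have h1 : 1 - 2 * t * V = (1 + 2 * a)⁻¹ := by
    rw [mul_assoc, htV]; field_simp; ring
  obtain ⟨hi, hle⟩ := integral_exp_sq_symmMix_le (m := halfDiff θ i) hσ ht0 (by
    have : 0 < (1 + 2 * a)⁻¹ := by positivity
    rw [← hV]; linarith)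
  rw [← hV, h1] at hle
  set K := t * ((1 + (√6 * a + 2 * a ^ 2)) * V) with hK
  have e (y : ℝ) : rexp (t * y ^ 2 - K) = rexp (t * y ^ 2) * rexp (-K) := by
    rw [← Real.exp_add]; ring_nf
  have hfin : √(1 + 2 * a) * rexp (-K) ≤ rexp (-a ^ 2) := by
    -- This is `y ≤ sinh y` at `y = log (1 + 2 a)`.
    have hlog : Real.log (1 + 2 * a) / 2 ≤ (a + a ^ 2) / (1 + 2 * a) := by
      have h0 : 0 ≤ Real.log (1 + 2 * a) := Real.log_nonneg (by linarith)
      have := Real.self_le_sinh_iff.2 h0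
      rw [Real.sinh_eq, Real.exp_neg, Real.exp_log (by positivity)] at this
      refine (div_le_div_of_nonneg_right this (by norm_num)).trans (le_of_eq ?_)
      field_simp; ring
    have h6 : 2 ≤ √6 := by
      apply Real.le_sqrt_of_sq_le; norm_num
    have hK' : (a + a ^ 2) / (1 + 2 * a) ≤ K - a ^ 2 := by
      have : K - a ^ 2 = (a + (√6 - 1) * a ^ 2) / (1 + 2 * a) := by
        rw [hK, mul_left_comm, htV]; field_simp; ring
      rw [this]
      gcongr
      nlinarith [sq_nonneg a]
    rw [Real.sqrt_eq_rpow, Real.rpow_def_of_pos (by positivity), ← Real.exp_add, Real.exp_le_exp]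
    linarith
  have := sampleLaw_coord_le n σ θ i (g := fun y => t * y ^ 2 - K) (c := a ^ 2)
    (by simp only [e]; exact hi.mul_const _) (by
      simp only [e]
      rw [integral_mul_const]
      refine le_trans ?_ hfin
      gcongr
      refine hle.trans (le_of_eq ?_)
      rw [Real.sqrt_inv, inv_inv])
  refine le_trans (measure_mono fun X hX => ?_) this
  simp only [Set.mem_ofPred_eq] at hX ⊢
  rw [Finset.sum_sub_distrib, ← Finset.mul_sum]
  simp only [Finset.sum_const, Finset.card_univ, Fintype.card_fin, nsmul_eq_mul]
  rw [hK]
  nlinarith [mul_le_mul_of_nonneg_left hX ht0]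

lemma sum_sq_lower_tail {d : ℕ} (n : ℕ) {σ a : ℝ} (hσ : 0 < σ) (ha : 0 ≤ a)
    (θ : EuclideanSpace ℝ (Fin d) × EuclideanSpace ℝ (Fin d)) (i : Fin d) :
    sampleLaw σ n θ {X | ∑ k, (X k i - center θ i) ^ 2 ≤
      n * ((1 - √6 * a) * (halfDiff θ i ^ 2 + σ ^ 2))} ≤ ENNReal.ofReal (rexp (-(n * a ^ 2))) := by
  set V := halfDiff θ i ^ 2 + σ ^ 2 with hV
  have hV0 : 0 < V := by positivity
  -- Minimises the exponent `-√6 a u + 3 u² / 2` in `u = t V`, with value `-a²`. The constant 6 in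
  -- `alpha` is what this lower tail needs; the upper tail only uses `2 ≤ √6`.
  set t := √6 * a / (3 * V) with ht
  have ht0 : 0 ≤ t := by positivity
  have htV : t * V = √6 * a / 3 := by rw [ht]; field_simp
  obtain ⟨hi, hle⟩ := integral_exp_neg_sq_symmMix_le (m := halfDiff θ i) (σ := σ) ht0
  set K := t * ((1 - √6 * a) * V) with hK
  have e (y : ℝ) : rexp (K - t * y ^ 2) = rexp (-(t * y ^ 2)) * rexp K := by
    rw [← Real.exp_add]; ring_nf
  have := sampleLaw_coord_le n σ θ i (g := fun y => K - t * y ^ 2) (c := a ^ 2)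
    (by simp only [e]; exact hi.mul_const _) (by
      simp only [e]
      rw [integral_mul_const]
      refine (mul_le_mul_of_nonneg_right hle (Real.exp_pos _).le).trans ?_
      rw [← hV, ← Real.exp_add, Real.exp_le_exp, hK, mul_left_comm, htV]
      have h6 : √6 ^ 2 = 6 := Real.sq_sqrt (by norm_num)
      apply le_of_eq
      linear_combination (-a ^ 2 / 6) * h6)
  refine le_trans (measure_mono fun X hX => ?_) this
  simp only [Set.mem_ofPred_eq] at hX ⊢
  simp only [Finset.sum_sub_distrib, ← Finset.mul_sum, Finset.sum_const, Finset.card_univ,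
    Fintype.card_fin, nsmul_eq_mul, hK]
  nlinarith [mul_le_mul_of_nonneg_left hX ht0]

lemma sum_tail {d : ℕ} (n : ℕ) {σ a : ℝ} (hσ : 0 < σ) (ha : 0 ≤ a)
    (θ : EuclideanSpace ℝ (Fin d) × EuclideanSpace ℝ (Fin d)) (i : Fin d)
    {ε : ℝ} (hε : ε ^ 2 = 1) :
    sampleLaw σ n θ {X | n * (√(2 * (halfDiff θ i ^ 2 + σ ^ 2)) * a) ≤
      ε * ∑ k, (X k i - center θ i)} ≤ ENNReal.ofReal (rexp (-(n * a ^ 2))) := by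
  set V := halfDiff θ i ^ 2 + σ ^ 2 with hV
  have hV0 : 0 < V := by positivity
  set b := √(2 * V) * a with hb
  have hb2 : b ^ 2 = 2 * V * a ^ 2 := by
    rw [hb, mul_pow, Real.sq_sqrt (by positivity)]
  have hb0 : 0 ≤ b := by positivity
  obtain ⟨hi, hle⟩ := integral_exp_mul_symmMix (halfDiff θ i) σ (ε * (b / V))
  set K := b / V * b with hK
  have e (y : ℝ) : rexp (ε * (b / V) * y - K) = rexp (ε * (b / V) * y) * rexp (-K) := by
    rw [← Real.exp_add]; ring_nf
  have := sampleLaw_coord_le n σ θ i (g := fun y => ε * (b / V) * y - K) (c := a ^ 2)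
    (by simp only [e]; exact hi.mul_const _) (by
      simp only [e]
      rw [integral_mul_const]
      refine (mul_le_mul_of_nonneg_right hle (Real.exp_pos _).le).trans ?_
      rw [← hV, ← Real.exp_add, Real.exp_le_exp, hK, mul_pow, hε]
      apply le_of_eq
      field_simp
      linear_combination -hb2)
  refine le_trans (measure_mono fun X hX => ?_) this
  simp only [Set.mem_ofPred_eq] at hX ⊢
  rw [Finset.sum_sub_distrib, ← Finset.mul_sum]
  simp only [Finset.sum_const, Finset.card_univ, Fintype.card_fin, nsmul_eq_mul]
  rw [hK]
  have h2 : 0 ≤ b / V := by positivity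
  nlinarith [mul_le_mul_of_nonneg_left hX h2]

/-- With probability at least `1 - 4 / n`, all the diagonal entries of the sample covariance are
within a factor `1 ± α` of the population variances. -/
lemma sampleCov_diag_concentration {d n : ℕ} (hd : 0 < d) (hn : 0 < n) {σ : ℝ} (hσ : 0 < σ)
    (θ : EuclideanSpace ℝ (Fin d) × EuclideanSpace ℝ (Fin d)) :
    sampleLaw σ n θ {X | ¬ ∀ i,
        (1 - alpha n d) * (halfDiff θ i ^ 2 + σ ^ 2) ≤ sampleCov X i i ∧
        sampleCov X i i ≤ (1 + alpha n d) * (halfDiff θ i ^ 2 + σ ^ 2)} ≤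
      ENNReal.ofReal (4 / n) := by
  have hn0 : (0 : ℝ) < n := by exact_mod_cast hn
  have hd0 : (0 : ℝ) < d := by exact_mod_cast hd
  have hL : 0 ≤ Real.log ((n : ℝ) * d) := by
    apply Real.log_nonneg
    have : 1 ≤ n * d := Nat.mul_pos hn hd
    exact_mod_cast this
  set a := √(Real.log ((n : ℝ) * d) / n) with ha
  have ha0 : 0 ≤ a := Real.sqrt_nonneg _
  have ha2 : a ^ 2 = Real.log ((n : ℝ) * d) / n := Real.sq_sqrt (by positivity)
  have hα : alpha n d = √6 * a + 2 * a ^ 2 := by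
    rw [alpha, ha2, ha, ← Real.sqrt_mul (by norm_num)]
    congr 1
    · congr 1; ring
    · ring
  -- Four tails of this size for each of `d` coordinates add up to `4 / n`.
  have hexp : rexp (-(n * a ^ 2)) = 1 / (n * d) := by
    rw [ha2, mul_div_cancel₀ _ hn0.ne', Real.exp_neg, Real.exp_log (by positivity), one_div]
  set V : Fin d → ℝ := fun i => halfDiff θ i ^ 2 + σ ^ 2 with hV
  have hV0 (i : Fin d) : 0 < V i := by simp only [hV]; positivity
  have hsub : {X : Fin n → EuclideanSpace ℝ (Fin d) | ¬ ∀ i,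
        (1 - alpha n d) * (halfDiff θ i ^ 2 + σ ^ 2) ≤ sampleCov X i i ∧
        sampleCov X i i ≤ (1 + alpha n d) * (halfDiff θ i ^ 2 + σ ^ 2)} ⊆
      ⋃ i, ({X | n * ((1 + (√6 * a + 2 * a ^ 2)) * V i) ≤ ∑ k, (X k i - center θ i) ^ 2} ∪
        {X | ∑ k, (X k i - center θ i) ^ 2 ≤ n * ((1 - √6 * a) * V i)}) ∪
        ({X | n * (√(2 * V i) * a) ≤ 1 * ∑ k, (X k i - center θ i)} ∪
        {X | n * (√(2 * V i) * a) ≤ (-1) * ∑ k, (X k i - center θ i)}) := by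
    intro X hX
    simp only [Set.mem_ofPred_eq, not_forall] at hX
    obtain ⟨i, hi⟩ := hX
    refine Set.mem_iUnion.2 ⟨i, ?_⟩
    by_contra hcon
    simp only [Set.mem_union, Set.mem_ofPred_eq, not_or, not_le] at hcon
    obtain ⟨⟨h1, h2⟩, h3, h4⟩ := hcon
    apply hi
    have hc := sampleCov_eq hn.ne' X (center θ) i i
    have hm := sampleMean_sub_apply hn.ne' X (center θ) i
    simp only [← pow_two] at hc
    set T := ∑ k, (X k i - center θ i) ^ 2
    set U := ∑ k, (X k i - center θ i)
    have hU : (sampleMean X i - center θ i) ^ 2 ≤ 2 * V i * a ^ 2 := by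
      have : |sampleMean X i - center θ i| ≤ √(2 * V i) * a := by
        rw [hm, abs_mul, abs_of_pos (by positivity), inv_mul_le_iff₀ hn0]
        exact abs_le.2 ⟨by linarith, by linarith⟩
      calc _ = |sampleMean X i - center θ i| ^ 2 := (sq_abs _).symm
        _ ≤ (√(2 * V i) * a) ^ 2 := by gcongr
        _ = _ := by rw [mul_pow, Real.sq_sqrt (by linarith [hV0 i])]
    have hT1 : (n : ℝ)⁻¹ * T ≤ (1 + (√6 * a + 2 * a ^ 2)) * V i := by
      rw [inv_mul_le_iff₀ hn0]; exact h1.le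
    have hT2 : (1 - √6 * a) * V i ≤ (n : ℝ)⁻¹ * T := by
      rw [le_inv_mul_iff₀ hn0]; exact h2.le
    rw [hα, hc]
    constructor
    -- On the lower side the term `2 a²` of `alpha` pays for the squared error of the sample mean;
    -- on the upper side it belongs to the chi-square tail.
    · have : (1 - (√6 * a + 2 * a ^ 2)) * V i = (1 - √6 * a) * V i - 2 * V i * a ^ 2 := by ring
      change (1 - (√6 * a + 2 * a ^ 2)) * V i ≤ _
      linarith
    · change _ ≤ (1 + (√6 * a + 2 * a ^ 2)) * V i
      linarith [sq_nonneg (sampleMean X i - center θ i)]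
  refine (measure_mono hsub).trans ((measure_iUnion_fintype_le _ _).trans ?_)
  calc _ ≤ ∑ _i : Fin d, ((ENNReal.ofReal (1 / (n * d)) + ENNReal.ofReal (1 / (n * d))) +
        (ENNReal.ofReal (1 / (n * d)) + ENNReal.ofReal (1 / (n * d)))) := by
        apply Finset.sum_le_sum
        intro i _
        rw [← hexp]
        refine (measure_union_le _ _).trans (add_le_add ((measure_union_le _ _).trans
          (add_le_add ?_ ?_)) ((measure_union_le _ _).trans (add_le_add ?_ ?_)))
        · exact sum_sq_upper_tail n hσ ha0 θ i
        · exact sum_sq_lower_tail n hσ ha0 θ i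
        · exact sum_tail n hσ ha0 θ i (by norm_num)
        · exact sum_tail n hσ ha0 θ i (by norm_num)
    _ = _ := by
        rw [← ENNReal.ofReal_add (by positivity) (by positivity),
          ← ENNReal.ofReal_add (by positivity) (by positivity)]
        rw [Finset.sum_const, Finset.card_univ, Fintype.card_fin, nsmul_eq_mul,
          ← ENNReal.ofReal_natCast, ← ENNReal.ofReal_mul (by positivity)]
        congr 1
        field_simp
        norm_num

/-! ### Second moments of the mixture and expected noise on a fixed support. -/

lemma integrable_mixture {d : ℕ} {σ : ℝ}
    {θ : EuclideanSpace ℝ (Fin d) × EuclideanSpace ℝ (Fin d)} {f : EuclideanSpace ℝ (Fin d) → ℝ}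
    (h1 : Integrable f (gauss σ θ.1)) (h2 : Integrable f (gauss σ θ.2)) :
    Integrable f (mixture σ θ) :=
  (h1.smul_measure (by simp)).add_measure (h2.smul_measure (by simp))

lemma integral_mixture {d : ℕ} {σ : ℝ}
    {θ : EuclideanSpace ℝ (Fin d) × EuclideanSpace ℝ (Fin d)} {f : EuclideanSpace ℝ (Fin d) → ℝ}
    (h1 : Integrable f (gauss σ θ.1)) (h2 : Integrable f (gauss σ θ.2)) :
    ∫ x, f x ∂(mixture σ θ) =
      2⁻¹ * ∫ x, f x ∂(gauss σ θ.1) + 2⁻¹ * ∫ x, f x ∂(gauss σ θ.2) := by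
  rw [mixture, integral_add_measure (h1.smul_measure (by simp))
    (h2.smul_measure (by simp)), integral_smul_measure, integral_smul_measure]
  simp

/-- The population covariance `σ² I + m mᵀ` of the mixture, `m` half the mean difference. -/
noncomputable def popCov {d : ℕ} (σ : ℝ)
    (θ : EuclideanSpace ℝ (Fin d) × EuclideanSpace ℝ (Fin d)) (i j : Fin d) : ℝ :=
  halfDiff θ i * halfDiff θ j + if i = j then σ ^ 2 else 0

lemma map_coord_gauss {d : ℕ} (σ : ℝ) (μ c : EuclideanSpace ℝ (Fin d)) (i : Fin d) :
    (gauss σ μ).map (fun x => x i - c i) = gaussianReal (μ i - c i) (σ ^ 2).toNNReal := by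
  have := gaussianReal_map_sub_const (μ := μ i) (v := (σ ^ 2).toNNReal) (c i)
  rw [← map_apply_gauss, Measure.map_map (by fun_prop) (by fun_prop)] at this
  simpa [Function.comp_def] using this

lemma integrable_coord_pow_gauss {d : ℕ} (σ : ℝ) (μ c : EuclideanSpace ℝ (Fin d)) (i : Fin d)
    (k : ℕ) : Integrable (fun x : EuclideanSpace ℝ (Fin d) => (x i - c i) ^ k) (gauss σ μ) := by
  have := integrable_pow_gaussianReal (μ i - c i) (σ ^ 2).toNNReal k
  rw [← map_coord_gauss] at this
  exact this.comp_measurable (by fun_prop)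

lemma integral_coord_pow_gauss {d : ℕ} (σ : ℝ) (μ c : EuclideanSpace ℝ (Fin d)) (i : Fin d)
    (k : ℕ) : ∫ x, (x i - c i) ^ k ∂(gauss σ μ) =
      ∫ x, x ^ k ∂(gaussianReal (μ i - c i) (σ ^ 2).toNNReal) := by
  rw [← map_coord_gauss, integral_map (by fun_prop) (by fun_prop)]

lemma integrable_coord_mul_sq_gauss {d : ℕ} (σ : ℝ) (μ c : EuclideanSpace ℝ (Fin d))
    (i j : Fin d) :
    Integrable (fun x : EuclideanSpace ℝ (Fin d) => ((x i - c i) * (x j - c j)) ^ 2)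
      (gauss σ μ) := by
  refine Integrable.mono' ((integrable_coord_pow_gauss σ μ c i 4).add
    (integrable_coord_pow_gauss σ μ c j 4)) (by fun_prop) (Filter.Eventually.of_forall fun x => ?_)
  rw [Real.norm_eq_abs, abs_of_nonneg (sq_nonneg _)]
  simp only [Pi.add_apply]
  nlinarith [sq_nonneg ((x i - c i) ^ 2 - (x j - c j) ^ 2), sq_nonneg ((x i - c i) ^ 2),
    sq_nonneg ((x j - c j) ^ 2)]

lemma integrable_coord_mul_gauss {d : ℕ} (σ : ℝ) (μ c : EuclideanSpace ℝ (Fin d))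
    (i j : Fin d) :
    Integrable (fun x : EuclideanSpace ℝ (Fin d) => (x i - c i) * (x j - c j)) (gauss σ μ) :=
  ((memLp_two_iff_integrable_sq (by fun_prop)).2
    (integrable_coord_mul_sq_gauss σ μ c i j)).integrable (by norm_num)

lemma integral_coord_mul_gauss {d : ℕ} (σ : ℝ) (μ c : EuclideanSpace ℝ (Fin d)) (i j : Fin d) :
    ∫ x, (x i - c i) * (x j - c j) ∂(gauss σ μ) =
      (μ i - c i) * (μ j - c j) + if i = j then σ ^ 2 else 0 := by
  split_ifs with hij
  · subst hij
    simp only [← pow_two]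
    rw [integral_coord_pow_gauss, (moments_gaussianReal _ _).1,
      Real.coe_toNNReal _ (sq_nonneg σ)]
  · have hind := (indepFun_apply_gauss σ μ hij).comp (φ := fun t : ℝ => t - c i)
      (ψ := fun t : ℝ => t - c j) (by fun_prop) (by fun_prop)
    have := hind.integral_mul_eq_mul_integral (by fun_prop) (by fun_prop)
    have e (i : Fin d) : ∫ x, (x i - c i) ∂(gauss σ μ) = μ i - c i := by
      have := integral_coord_pow_gauss σ μ c i 1
      simpa using this
    simp only [Function.comp_def, Pi.mul_apply] at this
    rw [this, e, e, add_zero]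

lemma integral_coord_mul_sq_gauss_le {d : ℕ} (σ : ℝ) (μ c : EuclideanSpace ℝ (Fin d))
    (i j : Fin d) :
    ∫ x, ((x i - c i) * (x j - c j)) ^ 2 ∂(gauss σ μ) ≤
      ((μ i - c i) * (μ j - c j) + if i = j then σ ^ 2 else 0) ^ 2 +
        2 * σ ^ 2 * ((μ i - c i) ^ 2 + (μ j - c j) ^ 2) + 2 * σ ^ 4 := by
  split_ifs with hij
  · subst hij
    have : ∀ x : EuclideanSpace ℝ (Fin d), ((x i - c i) * (x i - c i)) ^ 2 = (x i - c i) ^ 4 :=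
      fun x => by ring
    simp only [this]
    rw [integral_coord_pow_gauss, (moments_gaussianReal _ _).2,
      Real.coe_toNNReal _ (sq_nonneg σ)]
    apply le_of_eq; ring
  · have hind := (indepFun_apply_gauss σ μ hij).comp (φ := fun t : ℝ => (t - c i) ^ 2)
      (ψ := fun t : ℝ => (t - c j) ^ 2) (by fun_prop) (by fun_prop)
    have := hind.integral_mul_eq_mul_integral (by fun_prop) (by fun_prop)
    simp only [Function.comp_def, Pi.mul_apply] at this
    simp only [mul_pow]
    rw [this, integral_coord_pow_gauss, integral_coord_pow_gauss, (moments_gaussianReal _ _).1,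
      (moments_gaussianReal _ _).1, Real.coe_toNNReal _ (sq_nonneg σ)]
    nlinarith [mul_nonneg (sq_nonneg σ) (sq_nonneg (μ i - c i)),
      mul_nonneg (sq_nonneg σ) (sq_nonneg (μ j - c j)), sq_nonneg (σ ^ 2)]

section Mixture

variable {d : ℕ} (σ : ℝ) (θ : EuclideanSpace ℝ (Fin d) × EuclideanSpace ℝ (Fin d))

lemma fst_sub_center (i : Fin d) : θ.1 i - center θ i = halfDiff θ i := by
  simp [center, halfDiff]; ring

lemma snd_sub_center (i : Fin d) : θ.2 i - center θ i = -halfDiff θ i := by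
  simp [center, halfDiff]; ring

/-- Relative to `center θ` the components have means `±m`, and the product of two coordinates has
the same mean under both. Hence the mixture adds no between-component variance. -/
lemma mixture_crossMoment (i j : Fin d) :
    MemLp (fun x : EuclideanSpace ℝ (Fin d) =>
      (x i - center θ i) * (x j - center θ j) - popCov σ θ i j) 2 (mixture σ θ) ∧
    ∫ x, ((x i - center θ i) * (x j - center θ j) - popCov σ θ i j) ∂(mixture σ θ) = 0 ∧
    ∫ x, ((x i - center θ i) * (x j - center θ j) - popCov σ θ i j) ^ 2 ∂(mixture σ θ) ≤
      2 * σ ^ 2 * (halfDiff θ i ^ 2 + halfDiff θ j ^ 2) + 2 * σ ^ 4 := by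
  have i1 : Integrable (fun x : EuclideanSpace ℝ (Fin d) =>
      (x i - center θ i) * (x j - center θ j)) (mixture σ θ) :=
    integrable_mixture (integrable_coord_mul_gauss σ _ _ i j)
      (integrable_coord_mul_gauss σ _ _ i j)
  have i2 : Integrable (fun x : EuclideanSpace ℝ (Fin d) =>
      ((x i - center θ i) * (x j - center θ j)) ^ 2) (mixture σ θ) :=
    integrable_mixture (integrable_coord_mul_sq_gauss σ _ _ i j)
      (integrable_coord_mul_sq_gauss σ _ _ i j)
  have e1 : ∫ x, (x i - center θ i) * (x j - center θ j) ∂(mixture σ θ) = popCov σ θ i j := by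
    rw [integral_mixture (integrable_coord_mul_gauss σ _ _ i j)
      (integrable_coord_mul_gauss σ _ _ i j), integral_coord_mul_gauss, integral_coord_mul_gauss,
      fst_sub_center, fst_sub_center, snd_sub_center, snd_sub_center, popCov]
    ring
  have e2 : ∫ x, ((x i - center θ i) * (x j - center θ j)) ^ 2 ∂(mixture σ θ) ≤
      popCov σ θ i j ^ 2 + 2 * σ ^ 2 * (halfDiff θ i ^ 2 + halfDiff θ j ^ 2) + 2 * σ ^ 4 := by
    rw [integral_mixture (integrable_coord_mul_sq_gauss σ _ _ i j)
      (integrable_coord_mul_sq_gauss σ _ _ i j)]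
    have h1 := integral_coord_mul_sq_gauss_le σ θ.1 (center θ) i j
    have h2 := integral_coord_mul_sq_gauss_le σ θ.2 (center θ) i j
    rw [fst_sub_center, fst_sub_center] at h1
    rw [snd_sub_center, snd_sub_center, neg_mul_neg, neg_sq, neg_sq] at h2
    rw [popCov]
    linarith
  refine ⟨((memLp_two_iff_integrable_sq (by fun_prop)).2 i2).sub (memLp_const _), ?_, ?_⟩
  · rw [integral_sub i1 (integrable_const _), e1]; simp
  · have : ∀ x : EuclideanSpace ℝ (Fin d),
        ((x i - center θ i) * (x j - center θ j) - popCov σ θ i j) ^ 2 =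
        ((x i - center θ i) * (x j - center θ j)) ^ 2 -
          2 * popCov σ θ i j * ((x i - center θ i) * (x j - center θ j)) + popCov σ θ i j ^ 2 :=
      fun x => by ring
    simp only [this]
    rw [integral_add (f := fun x : EuclideanSpace ℝ (Fin d) =>
        ((x i - center θ i) * (x j - center θ j)) ^ 2 -
          2 * popCov σ θ i j * ((x i - center θ i) * (x j - center θ j)))
        (i2.sub (i1.const_mul _)) (integrable_const _),
      integral_sub i2 (i1.const_mul _), integral_const_mul, e1]
    simp
    nlinarith

lemma mixture_coord (i : Fin d) :
    MemLp (fun x : EuclideanSpace ℝ (Fin d) => x i - center θ i) 2 (mixture σ θ) ∧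
    ∫ x, (x i - center θ i) ∂(mixture σ θ) = 0 ∧
    ∫ x, (x i - center θ i) ^ 2 ∂(mixture σ θ) = halfDiff θ i ^ 2 + σ ^ 2 := by
  have i2 := integrable_mixture (integrable_coord_pow_gauss σ θ.1 (center θ) i 2)
      (integrable_coord_pow_gauss σ θ.2 (center θ) i 2)
  refine ⟨(memLp_two_iff_integrable_sq (by fun_prop)).2 i2, ?_, ?_⟩
  · have := integral_mixture (integrable_coord_pow_gauss σ θ.1 (center θ) i 1)
      (integrable_coord_pow_gauss σ θ.2 (center θ) i 1)
    rw [integral_coord_pow_gauss, integral_coord_pow_gauss, fst_sub_center,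
      snd_sub_center] at this
    simpa using this
  · rw [integral_mixture (integrable_coord_pow_gauss σ θ.1 (center θ) i 2)
      (integrable_coord_pow_gauss σ θ.2 (center θ) i 2), integral_coord_pow_gauss,
      integral_coord_pow_gauss, fst_sub_center, snd_sub_center, (moments_gaussianReal _ _).1,
      (moments_gaussianReal _ _).1, Real.coe_toNNReal _ (sq_nonneg σ)]
    ring

/-- The squared Frobenius norm on `S × S` of the deviation of the centred second moments. -/
noncomputable def frobNoise (S : Finset (Fin d)) {n : ℕ} (X : Fin n → EuclideanSpace ℝ (Fin d)) :
    ℝ :=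
  ∑ i ∈ S, ∑ j ∈ S, ((n : ℝ)⁻¹ *
    ∑ k, ((X k i - center θ i) * (X k j - center θ j) - popCov σ θ i j)) ^ 2

/-- The squared norm on `S` of the deviation of the sample mean from the centre. -/
noncomputable def meanNoise (S : Finset (Fin d)) {n : ℕ} (X : Fin n → EuclideanSpace ℝ (Fin d)) :
    ℝ :=
  ∑ i ∈ S, (sampleMean X i - center θ i) ^ 2

lemma integral_frobNoise_le (S : Finset (Fin d)) {n : ℕ} (hn : n ≠ 0) {R : ℝ}
    (hR : ∑ i ∈ S, halfDiff θ i ^ 2 ≤ R) :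
    Integrable (frobNoise σ θ S) (sampleLaw σ n θ) ∧
    ∫ X, frobNoise σ θ S X ∂(sampleLaw σ n θ) ≤
      (n : ℝ)⁻¹ * (4 * S.card * σ ^ 2 * R + 2 * S.card ^ 2 * σ ^ 4) := by
  have h (i j : Fin d) := integral_sq_empiricalMean (mixture σ θ) n hn
    (mixture_crossMoment σ θ i j).1 (mixture_crossMoment σ θ i j).2.1
  refine ⟨integrable_finsetSum _ fun i _ => integrable_finsetSum _ fun j _ => (h i j).1, ?_⟩
  unfold frobNoise sampleLaw
  rw [integral_finsetSum _ fun i _ => integrable_finsetSum _ fun j _ => (h i j).1]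
  calc _ = ∑ i ∈ S, ∑ j ∈ S, (n : ℝ)⁻¹ * ∫ x, ((x i - center θ i) * (x j - center θ j) -
        popCov σ θ i j) ^ 2 ∂(mixture σ θ) := by
        refine Finset.sum_congr rfl fun i _ => ?_
        rw [integral_finsetSum _ fun j _ => (h i j).1]
        exact Finset.sum_congr rfl fun j _ => (h i j).2
    _ ≤ ∑ i ∈ S, ∑ j ∈ S, (n : ℝ)⁻¹ *
        (2 * σ ^ 2 * (halfDiff θ i ^ 2 + halfDiff θ j ^ 2) + 2 * σ ^ 4) := by
        gcongr with i _ j _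
        exact (mixture_crossMoment σ θ i j).2.2
    _ = (n : ℝ)⁻¹ * (4 * S.card * σ ^ 2 * (∑ i ∈ S, halfDiff θ i ^ 2) +
          2 * S.card ^ 2 * σ ^ 4) := by
        simp only [← Finset.mul_sum, Finset.sum_add_distrib, Finset.sum_const, nsmul_eq_mul]
        ring
    _ ≤ _ := by gcongr

lemma integral_meanNoise_le (S : Finset (Fin d)) {n : ℕ} (hn : n ≠ 0) {R : ℝ}
    (hR : ∑ i ∈ S, halfDiff θ i ^ 2 ≤ R) :
    Integrable (meanNoise θ S) (sampleLaw σ n θ) ∧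
    ∫ X, meanNoise θ S X ∂(sampleLaw σ n θ) ≤ (n : ℝ)⁻¹ * (R + S.card * σ ^ 2) := by
  have h (i : Fin d) := integral_sq_empiricalMean (mixture σ θ) n hn
    (mixture_coord σ θ i).1 (mixture_coord σ θ i).2.1
  have e : (fun X : Fin n → EuclideanSpace ℝ (Fin d) => meanNoise θ S X) =
      fun X => ∑ i ∈ S, ((n : ℝ)⁻¹ * ∑ k, (X k i - center θ i)) ^ 2 := by
    funext X
    simp only [meanNoise, sampleMean_sub_apply hn]
  refine ⟨?_, ?_⟩
  · change Integrable (fun X => meanNoise θ S X) _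
    rw [e]
    exact integrable_finsetSum _ fun i _ => (h i).1
  · unfold sampleLaw
    rw [e, integral_finsetSum _ fun i _ => (h i).1]
    calc _ = ∑ i ∈ S, (n : ℝ)⁻¹ * (halfDiff θ i ^ 2 + σ ^ 2) := by
          refine Finset.sum_congr rfl fun i _ => ?_
          rw [← (mixture_coord σ θ i).2.2]
          exact (h i).2
      _ = (n : ℝ)⁻¹ * (∑ i ∈ S, halfDiff θ i ^ 2 + S.card * σ ^ 2) := by
          simp [← Finset.mul_sum, Finset.sum_add_distrib]
      _ ≤ _ := by gcongr

end Mixture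

/-! ### Perturbation of the leading eigenvector. -/

/-- A leading eigenvector of a symmetric matrix maximizes the quadratic form on the sphere. -/
lemma IsLeadingEigenvector.quadForm_le {d : ℕ} {A : Matrix (Fin d) (Fin d) ℝ} (hA : A.IsHermitian)
    {v : EuclideanSpace ℝ (Fin d)} (hv : IsLeadingEigenvector A v)
    (x : EuclideanSpace ℝ (Fin d)) (hx : ‖x‖ = 1) :
    x.ofLp ⬝ᵥ A.mulVec x.ofLp ≤ v.ofLp ⬝ᵥ A.mulVec v.ofLp := by
  obtain ⟨hv1, c, hc, hmax⟩ := hv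
  have hvc : v.ofLp ⬝ᵥ A.mulVec v.ofLp = c := by
    have : v.ofLp ⬝ᵥ v.ofLp = 1 := by
      have := EuclideanSpace.real_norm_sq_eq v
      rw [hv1] at this
      simp only [dotProduct, ← pow_two]
      linarith
    rw [hc, dotProduct_smul, this, smul_eq_mul, mul_one]
  have hle (j : Fin d) : hA.eigenvalues j ≤ c := by
    refine hmax _ (hA.eigenvectorBasis j).ofLp ?_ (hA.mulVec_eigenvectorBasis j)
    intro h0
    have h1 := hA.eigenvectorBasis.orthonormal.1 j
    have : hA.eigenvectorBasis j = 0 := by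
      ext i; exact congrFun h0 i
    rw [this] at h1; simp at h1
  set y : EuclideanSpace ℝ (Fin d) := WithLp.toLp 2 (A.mulVec x.ofLp) with hy
  have hxy : x.ofLp ⬝ᵥ A.mulVec x.ofLp = ⟪x, y⟫ := by
    simp [PiLp.inner_apply, dotProduct, hy, mul_comm]
  have hby (j : Fin d) : ⟪hA.eigenvectorBasis j, y⟫ =
      hA.eigenvalues j * ⟪hA.eigenvectorBasis j, x⟫ := by
    have e1 : ⟪hA.eigenvectorBasis j, y⟫ =
        (hA.eigenvectorBasis j).ofLp ⬝ᵥ A.mulVec x.ofLp := by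
      simp [PiLp.inner_apply, dotProduct, hy, mul_comm]
    have hAt : A.transpose = A := by
      rw [← Matrix.conjTranspose_eq_transpose_of_trivial]; exact hA.eq
    rw [e1, Matrix.dotProduct_mulVec, ← Matrix.mulVec_transpose, hAt, hA.mulVec_eigenvectorBasis]
    simp [PiLp.inner_apply, dotProduct, mul_comm, Finset.mul_sum, mul_left_comm]
  rw [hvc, hxy, ← hA.eigenvectorBasis.sum_inner_mul_inner x y]
  calc _ ≤ ∑ j, c * (⟪x, hA.eigenvectorBasis j⟫ * ⟪hA.eigenvectorBasis j, x⟫) := by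
        apply Finset.sum_le_sum
        intro j _
        rw [hby, real_inner_comm x]
        nlinarith [mul_le_mul_of_nonneg_right (hle j)
          (mul_self_nonneg ⟪x, hA.eigenvectorBasis j⟫)]
    _ = c := by
        rw [← Finset.mul_sum, hA.eigenvectorBasis.sum_inner_mul_inner,
          real_inner_self_eq_norm_sq, hx]; ring

lemma restrict_dotProduct {d : ℕ} (T : Finset (Fin d)) (A : Matrix (Fin d) (Fin d) ℝ)
    (x : Fin d → ℝ) :
    x ⬝ᵥ (restrict T A).mulVec x = ∑ i ∈ T, ∑ j ∈ T, x i * A i j * x j := by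
  simp only [dotProduct, Matrix.mulVec, restrict, Matrix.of_apply, Finset.mul_sum]
  rw [← Finset.sum_subset (Finset.subset_univ T)]
  · refine Finset.sum_congr rfl fun i hi => ?_
    rw [← Finset.sum_subset (Finset.subset_univ T)]
    · refine Finset.sum_congr rfl fun j hj => ?_
      simp [hi, hj, mul_assoc]
    · intro j _ hj; simp [hj]
  · intro i _ hi; simp [hi]

lemma restrict_isHermitian {d : ℕ} (T : Finset (Fin d)) {A : Matrix (Fin d) (Fin d) ℝ}
    (hA : ∀ i j, A i j = A j i) : (restrict T A).IsHermitian := by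
  ext i j
  simp only [restrict, Matrix.conjTranspose_apply, Matrix.of_apply, star_trivial, hA i j, and_comm]

/-- A sine-theta bound: the leading eigenvector of a perturbation of `σ² I + m mᵀ`, restricted to
the coordinates in `T`, has a small angle with the restriction of `m`. -/
lemma leadingEigenvector_angle {d : ℕ} (T : Finset (Fin d)) {A : Matrix (Fin d) (Fin d) ℝ}
    (hA : ∀ i j, A i j = A j i) (m : Fin d → ℝ) {v : EuclideanSpace ℝ (Fin d)} {σ D : ℝ}
    (hv : IsLeadingEigenvector (restrict T A) v)
    (hD : ∀ a b : Fin d → ℝ, |∑ i ∈ T, ∑ j ∈ T,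
        a i * (A i j - (m i * m j + if i = j then σ ^ 2 else 0)) * b j| ≤
      D * (√(∑ i ∈ T, a i ^ 2) * √(∑ i ∈ T, b i ^ 2)))
    (hp : 0 < ∑ i ∈ T, m i ^ 2) :
    (∑ i ∈ T, m i ^ 2) * (∑ i ∈ T, m i ^ 2 - (∑ i ∈ T, m i * v i) ^ 2) ≤ 4 * D ^ 2 := by
  set p := ∑ i ∈ T, m i ^ 2 with hpdef
  set g := ∑ i ∈ T, m i * v i with hg
  set Er : Fin d → Fin d → ℝ := fun i j => A i j - (m i * m j + if i = j then σ ^ 2 else 0)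
    with hEr
  have hErs (i j : Fin d) : Er i j = Er j i := by
    simp only [hEr, hA i j, mul_comm (m i), eq_comm (a := i)]
  set Q : (Fin d → ℝ) → ℝ := fun x => ∑ i ∈ T, ∑ j ∈ T, x i * Er i j * x j with hQ
  have hquad (x : Fin d → ℝ) : ∑ i ∈ T, ∑ j ∈ T, x i * A i j * x j =
      (∑ i ∈ T, m i * x i) ^ 2 + σ ^ 2 * ∑ i ∈ T, x i ^ 2 + Q x := by
    have e (i j : Fin d) : x i * A i j * x j = (m i * x i) * (m j * x j) +
        (if i = j then σ ^ 2 * x i ^ 2 else 0) + x i * Er i j * x j := by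
      simp only [hEr]
      split_ifs with h
      · subst h; ring
      · ring
    simp only [e, Finset.sum_add_distrib, hQ]
    congr 2
    · rw [pow_two, Finset.sum_mul_sum]
    · rw [Finset.mul_sum]
      refine Finset.sum_congr rfl fun i hi => ?_
      rw [Finset.sum_ite_eq, if_pos hi]
  set M := √p with hM
  have hM0 : 0 < M := Real.sqrt_pos.2 hp
  have hM2 : M ^ 2 = p := Real.sq_sqrt hp.le
  -- The unperturbed leading eigenvector, used as competitor to `v` in the variational
  -- characterisation.
  set e : Fin d → ℝ := fun i => if i ∈ T then m i / M else 0 with he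
  have heT (i : Fin d) (hi : i ∈ T) : e i = m i / M := by simp [he, hi]
  have he2 : ∑ i ∈ T, e i ^ 2 = 1 := by
    rw [Finset.sum_congr rfl fun i hi => by rw [heT i hi, div_pow], ← Finset.sum_div, hM2,
      div_self hp.ne']
  have hme : ∑ i ∈ T, m i * e i = M := by
    rw [Finset.sum_congr rfl (g := fun i => m i ^ 2 / M) fun i hi => by rw [heT i hi]; ring,
      ← Finset.sum_div, ← hpdef, ← hM2]
    field_simp
  have henorm : ‖(WithLp.toLp 2 e : EuclideanSpace ℝ (Fin d))‖ = 1 := by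
    have : ‖(WithLp.toLp 2 e : EuclideanSpace ℝ (Fin d))‖ ^ 2 = 1 := by
      rw [EuclideanSpace.real_norm_sq_eq, ← he2]
      symm
      apply Finset.sum_subset (Finset.subset_univ T)
      intro i _ hi; simp [he, hi]
    nlinarith [norm_nonneg (WithLp.toLp 2 e : EuclideanSpace ℝ (Fin d))]
  have hvT : ∑ i ∈ T, v i ^ 2 ≤ 1 := by
    have := EuclideanSpace.real_norm_sq_eq v
    rw [hv.1] at this
    calc _ ≤ ∑ i, v i ^ 2 := Finset.sum_le_sum_of_subset_of_nonneg (Finset.subset_univ T)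
          fun i _ _ => sq_nonneg _
      _ = 1 := by linarith
  have hmain := hv.quadForm_le (restrict_isHermitian T hA) (WithLp.toLp 2 e) henorm
  rw [restrict_dotProduct, restrict_dotProduct, hquad, hquad, hme, he2, hM2] at hmain
  have hz : p - g ^ 2 ≤ Q v.ofLp - Q e := by
    nlinarith [mul_le_mul_of_nonneg_left hvT (sq_nonneg σ)]
  -- Symmetry of the error factors the difference of quadratic forms. The factor `v - e` is itself
  -- small with the angle, which makes the sine linear in `D` rather than of order `√D`.
  have hdiff : Q v.ofLp - Q e = ∑ i ∈ T, ∑ j ∈ T, (v i - e i) * Er i j * (v j + e j) := by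
    have h1 : ∑ i ∈ T, ∑ j ∈ T, v i * Er i j * e j = ∑ i ∈ T, ∑ j ∈ T, e i * Er i j * v j := by
      rw [Finset.sum_comm]
      refine Finset.sum_congr rfl fun i _ => Finset.sum_congr rfl fun j _ => ?_
      rw [hErs]; ring
    have h2 (i j : Fin d) : (v i - e i) * Er i j * (v j + e j) = v i * Er i j * v j +
        v i * Er i j * e j - e i * Er i j * v j - e i * Er i j * e j := by ring
    simp only [h2, Finset.sum_add_distrib, Finset.sum_sub_distrib, h1, hQ]
    ring
  have hcross : ∑ i ∈ T, v i * e i = g / M := by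
    rw [hg, Finset.sum_div]
    refine Finset.sum_congr rfl fun i hi => ?_
    rw [heT i hi]; ring
  have hminus : ∑ i ∈ T, (v i - e i) ^ 2 ≤ 2 - 2 * (g / M) := by
    have h2 (i : Fin d) : (v i - e i) ^ 2 = v i ^ 2 - 2 * (v i * e i) + e i ^ 2 := by ring
    simp only [h2, Finset.sum_add_distrib, Finset.sum_sub_distrib, ← Finset.mul_sum, hcross, he2]
    linarith
  have hplus : ∑ i ∈ T, (v i + e i) ^ 2 ≤ 2 + 2 * (g / M) := by
    have h2 (i : Fin d) : (v i + e i) ^ 2 = v i ^ 2 + 2 * (v i * e i) + e i ^ 2 := by ring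
    simp only [h2, Finset.sum_add_distrib, ← Finset.mul_sum, hcross, he2]
    linarith
  have hgM : (g / M) ^ 2 = g ^ 2 / p := by rw [div_pow, hM2]
  have hb := hD (fun i => v i - e i) (fun i => v i + e i)
  set a1 := ∑ i ∈ T, (v i - e i) ^ 2
  set a2 := ∑ i ∈ T, (v i + e i) ^ 2
  have ha1 : 0 ≤ a1 := Finset.sum_nonneg fun i _ => sq_nonneg _
  have ha2 : 0 ≤ a2 := Finset.sum_nonneg fun i _ => sq_nonneg _
  set z := p - g ^ 2 with hzdef
  rcases le_or_gt z 0 with hz0 | hz0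
  · nlinarith [sq_nonneg D, mul_nonneg hp.le (neg_nonneg.2 hz0)]
  have hzle : z ≤ D * (√a1 * √a2) := by
    rw [hdiff] at hz
    exact hz.trans ((le_abs_self _).trans hb)
  -- The product of the two squared norms is at most `4 (1 - cos²)`, the squared sine again, so one
  -- factor `z` cancels from `z² ≤ 4 D² z / p`.
  have hprod : a1 * a2 ≤ 4 * (z / p) := by
    have h3 : 4 * (z / p) = (2 - 2 * (g / M)) * (2 + 2 * (g / M)) := by
      rw [hzdef, sub_div, div_self hp.ne', ← hgM]; ring
    rw [h3]
    exact mul_le_mul hminus hplus ha2 (ha1.trans hminus)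
  have hsq : z ^ 2 ≤ D ^ 2 * (4 * (z / p)) := by
    calc z ^ 2 ≤ (D * (√a1 * √a2)) ^ 2 := by gcongr
      _ = D ^ 2 * (a1 * a2) := by
          rw [mul_pow, mul_pow, Real.sq_sqrt ha1, Real.sq_sqrt ha2]
      _ ≤ _ := by gcongr
  have h4 : z ^ 2 * p ≤ 4 * D ^ 2 * z := by
    calc z ^ 2 * p ≤ D ^ 2 * (4 * (z / p)) * p := by gcongr
      _ = _ := by field_simp
  have h5 : z * (p * z) ≤ z * (4 * D ^ 2) := by linarith
  exact le_of_mul_le_mul_left h5 hz0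

/-! ### Deterministic analysis of the coordinate selection. -/

section Selection

variable {d n : ℕ} {σ : ℝ} {θ : EuclideanSpace ℝ (Fin d) × EuclideanSpace ℝ (Fin d)}
  {X : Fin n → EuclideanSpace ℝ (Fin d)}

/-- The factor `(1 + α) / (1 - α)` lifts the least possible minimum `(1 - α) σ²` to the largest
sample variance that an irrelevant coordinate can show. -/
lemma threshold_ge (hα0 : 0 ≤ alpha n d) (hα : alpha n d ≤ 1 / 4) (hd : 0 < d)
    (hX : ∀ i, (1 - alpha n d) * (halfDiff θ i ^ 2 + σ ^ 2) ≤ sampleCov X i i) :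
    (1 + alpha n d) * σ ^ 2 ≤ threshold X := by
  have : Nonempty (Fin d) := ⟨⟨0, hd⟩⟩
  have hinf : (1 - alpha n d) * σ ^ 2 ≤ ⨅ i, sampleCov X i i := by
    refine le_ciInf fun i => le_trans ?_ (hX i)
    have : 0 ≤ 1 - alpha n d := by linarith
    gcongr
    nlinarith [sq_nonneg (halfDiff θ i)]
  have h1 : 0 < 1 - alpha n d := by linarith
  rw [threshold]
  calc _ = (1 + alpha n d) / (1 - alpha n d) * ((1 - alpha n d) * σ ^ 2) := by field_simp
    _ ≤ _ := by gcongr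

/-- On the concentration event only relevant coordinates are selected. -/
lemma halfDiff_ne_zero_of_mem_selected (hα0 : 0 ≤ alpha n d) (hα : alpha n d ≤ 1 / 4)
    (hd : 0 < d)
    (hX : ∀ i, (1 - alpha n d) * (halfDiff θ i ^ 2 + σ ^ 2) ≤ sampleCov X i i ∧
        sampleCov X i i ≤ (1 + alpha n d) * (halfDiff θ i ^ 2 + σ ^ 2))
    {i : Fin d} (hi : i ∈ selected X) : halfDiff θ i ≠ 0 := by
  intro h0
  have h1 : threshold X < sampleCov X i i := by simpa [selected] using hi
  have h2 := threshold_ge hα0 hα hd fun i => (hX i).1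
  have h3 := (hX i).2
  rw [h0] at h3
  linarith

/-- On the concentration event the coordinates that are not selected carry little signal. -/
lemma halfDiff_sq_le_of_notMem_selected (hα0 : 0 ≤ alpha n d) (hα : alpha n d ≤ 1 / 4)
    (hX : ∀ i, (1 - alpha n d) * (halfDiff θ i ^ 2 + σ ^ 2) ≤ sampleCov X i i ∧
        sampleCov X i i ≤ (1 + alpha n d) * (halfDiff θ i ^ 2 + σ ^ 2))
    {i₀ : Fin d} (hi₀ : halfDiff θ i₀ = 0) {i : Fin d} (hi : i ∉ selected X) :
    halfDiff θ i ^ 2 ≤ 64 / 9 * alpha n d * σ ^ 2 := by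
  have h1 : sampleCov X i i ≤ threshold X := by simpa [selected] using hi
  have hinf : ⨅ i, sampleCov X i i ≤ (1 + alpha n d) * σ ^ 2 := by
    have h3 := (hX i₀).2
    rw [hi₀] at h3
    exact (ciInf_le (Set.finite_range _).bddBelow i₀).trans (by linarith)
  have hp : 0 < 1 - alpha n d := by linarith
  have h4 : threshold X ≤ (1 + alpha n d) / (1 - alpha n d) * ((1 + alpha n d) * σ ^ 2) := by
    rw [threshold]; gcongr
  have h5 := ((hX i).1.trans h1).trans h4
  rw [div_mul_eq_mul_div, le_div_iff₀ hp] at h5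
  set a := alpha n d
  -- `(1 + a)² - (1 - a)² = 4 a`; dividing by `(1 - a)² ≥ 9 / 16` gives the constant `64 / 9`.
  have h6 : (1 - a) ^ 2 * halfDiff θ i ^ 2 ≤ 4 * a * σ ^ 2 := by nlinarith
  have h7 : (3 / 4 : ℝ) ^ 2 ≤ (1 - a) ^ 2 := by gcongr; linarith
  nlinarith [mul_le_mul_of_nonneg_right h7 (sq_nonneg (halfDiff θ i))]

end Selection

/-! ### Loss of a linear clusterer. -/

section Loss

variable {d : ℕ} {σ : ℝ} {θ : EuclideanSpace ℝ (Fin d) × EuclideanSpace ℝ (Fin d)}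

lemma loss_le_one (F : EuclideanSpace ℝ (Fin d) → Fin 2) : loss σ θ F ≤ 1 :=
  (iInf_le _ 1).trans prob_le_one

lemma bayes_eq_zero_iff (hσ : 0 < σ) (x : EuclideanSpace ℝ (Fin d)) :
    bayes σ θ x = 0 ↔ 0 ≤ ⟪halfDiff θ, x - center θ⟫ := by
  have h1 : bayes σ θ x = 0 ↔ gaussianDensity σ θ.2 x ≤ gaussianDensity σ θ.1 x := by
    unfold bayes; split_ifs with h <;> simp [h]
  have hpos : (0 : ℝ) < (2 * π * σ ^ 2) ^ (-(d : ℝ) / 2) := by positivity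
  rw [h1, gaussianDensity, gaussianDensity, mul_le_mul_iff_right₀ hpos, Real.exp_le_exp,
    div_le_div_iff_of_pos_right (by positivity), neg_le_neg_iff]
  have e1 : x - θ.1 = (x - center θ) - halfDiff θ := by
    ext i; simp [center, halfDiff]; ring
  have e2 : x - θ.2 = (x - center θ) + halfDiff θ := by
    ext i; simp [center, halfDiff]; ring
  rw [e1, e2, norm_sub_sq_real, norm_add_sq_real, real_inner_comm]
  constructor <;> intro h <;> linarith

/-- The loss of a linear clusterer `x ↦ 𝟙 {b ≤ ⟪w, x - c⟫}`, `c` the centre of the mixture, through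
the correlation of `w` with the discriminant direction. -/
lemma loss_linear_le (hσ : 0 < σ) (hm : halfDiff θ ≠ 0) {F : EuclideanSpace ℝ (Fin d) → Fin 2}
    {w : EuclideanSpace ℝ (Fin d)} {b κ τ ρ h : ℝ} (hρ : ρ = ‖halfDiff θ‖)
    (hF : ∀ x, F x = 0 ↔ b ≤ ⟪w, x - center θ⟫) (hb : |b| ≤ h)
    (hκ : ρ * κ = ⟪halfDiff θ, w⟫) (hκ0 : κ ≠ 0) (hτ0 : 0 ≤ τ) (hτ : ‖w‖ ^ 2 - κ ^ 2 ≤ τ ^ 2) :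
    loss σ θ F ≤ ENNReal.ofReal (τ / |κ| + 2 * h / (|κ| * max ρ σ)) := by
  have hh : 0 ≤ h := (abs_nonneg b).trans hb
  have hρ0 : 0 < ρ := by rw [hρ]; exact norm_pos_iff.2 hm
  set u := ρ⁻¹ • halfDiff θ with hu
  have hu1 : ‖u‖ = 1 := by
    rw [hu, norm_smul, ← hρ, Real.norm_eq_abs, abs_of_pos (by positivity)]
    field_simp
  have hmu : halfDiff θ = ρ • u := by rw [hu, smul_smul, mul_inv_cancel₀ hρ0.ne', one_smul]
  have huw : ⟪u, w⟫ = κ := by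
    rw [hu, real_inner_smul_left, ← hκ]; field_simp
  have huu : ⟪u, u⟫ = (1 : ℝ) := by rw [real_inner_self_eq_norm_sq, hu1]; norm_num
  set w' := w - κ • u with hw'
  have huw' : ⟪u, w'⟫ = (0 : ℝ) := by
    rw [hw', inner_sub_right, real_inner_smul_right, huw, huu]; ring
  have hww' : w = κ • u + w' := by rw [hw']; abel
  have hnw' : ‖w'‖ ≤ τ := by
    have : ‖w'‖ ^ 2 = ‖w‖ ^ 2 - κ ^ 2 := by
      rw [hw', norm_sub_sq_real, real_inner_smul_right, real_inner_comm, huw, norm_smul, hu1,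
        mul_one, Real.norm_eq_abs, sq_abs]; ring
    exact le_of_sq_le_sq (by linarith) hτ0
  set c := center θ with hc
  set B : Set (EuclideanSpace ℝ (Fin d)) :=
    {x | |⟪u, x⟫ - ⟪u, c⟫| ≤ |κ|⁻¹ * |⟪w', x⟫ - ⟪w', c⟫| + h / |κ|} with hB
  have hκa : 0 < |κ| := abs_pos.2 hκ0
  have hdec (x : EuclideanSpace ℝ (Fin d)) :
      ⟪w, x - c⟫ = κ * ⟪u, x - c⟫ + ⟪w', x - c⟫ := by
    conv_lhs => rw [hww']
    rw [inner_add_left, real_inner_smul_left]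
  have hbay (x : EuclideanSpace ℝ (Fin d)) : bayes σ θ x = 0 ↔ 0 ≤ ⟪u, x - c⟫ := by
    rw [bayes_eq_zero_iff hσ, hmu, real_inner_smul_left, mul_nonneg_iff_of_pos_left hρ0]
  have hmemB (x : EuclideanSpace ℝ (Fin d))
      (hx : |κ| * |⟪u, x - c⟫| ≤ |⟪w', x - c⟫| + |b|) : x ∈ B := by
    simp only [hB, Set.mem_ofPred_eq, ← inner_sub_right]
    have h2 : |κ| * |⟪u, x - c⟫| ≤ |⟪w', x - c⟫| + h := by linarith
    calc _ ≤ (|⟪w', x - c⟫| + h) / |κ| := by rw [le_div_iff₀ hκa]; linarith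
      _ = _ := by ring
  have hf2 (a : Fin 2) : ¬a = 0 ↔ a = 1 := by omega
  -- The rules compare the signs of `A` and `κ A + W - b`. If `κ > 0`, a disagreement forces `|κ|
  -- |A| ≤ |W| + |b|`; if `κ < 0`, the same holds after swapping the labels.
  have hsub : ∃ e : Equiv.Perm (Fin 2), {x | bayes σ θ x ≠ e (F x)} ⊆ B := by
    rcases hκ0.lt_or_gt with hneg | hpos
    · refine ⟨Equiv.swap 0 1, fun x hx => hmemB x ?_⟩
      have h1 := hbay x
      have h2 := hF x
      rw [hdec] at h2
      rw [abs_of_neg hneg]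
      simp only [Set.mem_ofPred_eq] at hx
      generalize ⟪u, x - c⟫ = A at *
      generalize ⟪w', x - c⟫ = W at *
      have k1 := le_abs_self W
      have k2 := neg_abs_le W
      have k3 := le_abs_self b
      have k4 := neg_abs_le b
      by_cases hA : 0 ≤ A
      · have hF0 : F x = 0 := by
          by_contra hne
          rw [hf2] at hne
          exact hx (by rw [h1.2 hA, hne]; simp)
        rw [abs_of_nonneg hA]
        linarith [h2.1 hF0]
      · have hF1 : F x ≠ 0 := by
          intro h0
          exact hx (by rw [h0]; simpa [hf2] using mt h1.1 hA)
        rw [abs_of_neg (by linarith)]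
        have := not_le.1 (mt h2.2 hF1)
        linarith
    · refine ⟨1, fun x hx => hmemB x ?_⟩
      have h1 := hbay x
      have h2 := hF x
      rw [hdec] at h2
      rw [abs_of_pos hpos]
      simp only [Set.mem_ofPred_eq, Equiv.Perm.coe_one, id_eq] at hx
      generalize ⟪u, x - c⟫ = A at *
      generalize ⟪w', x - c⟫ = W at *
      have k1 := le_abs_self W
      have k2 := neg_abs_le W
      have k3 := le_abs_self b
      have k4 := neg_abs_le b
      by_cases hA : 0 ≤ A
      · have hF0 : F x ≠ 0 := by
          intro h0
          exact hx (by rw [h1.2 hA, h0])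
        rw [abs_of_nonneg hA]
        have := not_le.1 (mt h2.2 hF0)
        linarith
      · have hF1 : F x = 0 := by
          by_contra h0
          have h3 := mt h1.1 hA
          rw [hf2] at h0 h3
          exact hx (by rw [h0, h3])
        rw [abs_of_neg (by linarith)]
        linarith [h2.1 hF1]
  -- Both means `c ± m` project to `c` across `u` and lie at distance `ρ` from the hyperplane, so
  -- the two components obey the same bound.
  have hcomp (μ : EuclideanSpace ℝ (Fin d)) (ε : ℝ) (hε : |ε| = 1)
      (hμ : μ = c + ε • halfDiff θ) :
      gauss σ μ B ≤ ENNReal.ofReal (τ / |κ| + 2 * h / (|κ| * max ρ σ)) := by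
    have e1 : ⟪w', μ⟫ = ⟪w', c⟫ := by
      rw [hμ, inner_add_right, real_inner_smul_right, hmu, real_inner_smul_right,
        real_inner_comm u w', huw']; ring
    have e2 : |⟪u, μ⟫ - ⟪u, c⟫| = ρ := by
      rw [hμ, inner_add_right, real_inner_smul_right, hmu, real_inner_smul_right, huu, mul_one,
        add_sub_cancel_left, abs_mul, hε, abs_of_pos hρ0, one_mul]
    refine (gauss_cone_le hσ μ hu1 huw' ⟪u, c⟫ ⟪w', c⟫ e1 (by positivity)
      (by positivity)).trans (ENNReal.ofReal_le_ofReal ?_)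
    rw [e2]
    have : 2 * (h / |κ|) / max ρ σ = 2 * h / (|κ| * max ρ σ) := by
      have : 0 < max ρ σ := lt_max_of_lt_right hσ
      field_simp
    rw [this, inv_mul_eq_div]
    gcongr
  obtain ⟨e', he'⟩ := hsub
  calc loss σ θ F ≤ mixture σ θ {x | bayes σ θ x ≠ e' (F x)} := iInf_le _ e'
    _ ≤ mixture σ θ B := measure_mono he'
    _ = 2⁻¹ * gauss σ θ.1 B + 2⁻¹ * gauss σ θ.2 B := by simp [mixture]
    _ ≤ 2⁻¹ * ENNReal.ofReal (τ / |κ| + 2 * h / (|κ| * max ρ σ)) +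
        2⁻¹ * ENNReal.ofReal (τ / |κ| + 2 * h / (|κ| * max ρ σ)) := by
        gcongr
        · exact hcomp _ 1 (by simp) (by ext i; simp [hc, center, halfDiff]; ring)
        · exact hcomp _ (-1) (by simp) (by ext i; simp [hc, center, halfDiff]; ring)
    _ = _ := by rw [← add_mul, ENNReal.inv_two_add_inv_two, one_mul]

end Loss

/-! ### Loss of the clusterer for a given sample. -/

section

variable {d n : ℕ} {σ : ℝ} {θ : EuclideanSpace ℝ (Fin d) × EuclideanSpace ℝ (Fin d)}
  {X : Fin n → EuclideanSpace ℝ (Fin d)}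

lemma abs_sum_mul_le_sqrt_mul_sqrt {ι : Type*} (s : Finset ι) (f g : ι → ℝ) :
    |∑ i ∈ s, f i * g i| ≤ √(∑ i ∈ s, f i ^ 2) * √(∑ i ∈ s, g i ^ 2) := by
  rw [← Real.sqrt_mul (Finset.sum_nonneg fun i _ => sq_nonneg _)]
  exact Real.abs_le_sqrt (Finset.sum_mul_sq_le_sq_mul_sq s f g)

lemma frobNoise_mono {T S : Finset (Fin d)} (h : T ⊆ S) :
    frobNoise σ θ T X ≤ frobNoise σ θ S X := by
  unfold frobNoise
  calc _ ≤ ∑ i ∈ T, ∑ j ∈ S, ((n : ℝ)⁻¹ *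
        ∑ k, ((X k i - center θ i) * (X k j - center θ j) - popCov σ θ i j)) ^ 2 :=
        Finset.sum_le_sum fun i _ => Finset.sum_le_sum_of_subset_of_nonneg h
          fun _ _ _ => sq_nonneg _
    _ ≤ _ := Finset.sum_le_sum_of_subset_of_nonneg h
          fun _ _ _ => Finset.sum_nonneg fun _ _ => sq_nonneg _

lemma meanNoise_mono {T S : Finset (Fin d)} (h : T ⊆ S) :
    meanNoise θ T X ≤ meanNoise θ S X :=
  Finset.sum_le_sum_of_subset_of_nonneg h fun _ _ _ => sq_nonneg _

lemma meanNoise_nonneg (S : Finset (Fin d)) : 0 ≤ meanNoise θ S X :=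
  Finset.sum_nonneg fun _ _ => sq_nonneg _

/-- The deviation of the sample covariance from the population covariance, as a bilinear form. -/
lemma sampleCov_bilin_le (hn : n ≠ 0) {T S : Finset (Fin d)} (hTS : T ⊆ S) (a b : Fin d → ℝ) :
    |∑ i ∈ T, ∑ j ∈ T, a i * (sampleCov X i j - popCov σ θ i j) * b j| ≤
      (√(frobNoise σ θ S X) + meanNoise θ S X) *
        (√(∑ i ∈ T, a i ^ 2) * √(∑ i ∈ T, b i ^ 2)) := by
  have hn' : (n : ℝ) ≠ 0 := by exact_mod_cast hn
  set y : Fin d → ℝ := fun i => sampleMean X i - center θ i with hy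
  set M : Fin d → Fin d → ℝ := fun i j => (n : ℝ)⁻¹ *
    ∑ k, ((X k i - center θ i) * (X k j - center θ j) - popCov σ θ i j) with hM
  have hE (i j : Fin d) : sampleCov X i j - popCov σ θ i j = M i j - y i * y j := by
    rw [sampleCov_eq hn X (center θ)]
    simp only [hM, hy, Finset.sum_sub_distrib, Finset.sum_const, Finset.card_univ,
      Fintype.card_fin, nsmul_eq_mul]
    field_simp
    ring
  -- Second-moment error minus the rank-one correction from the sample mean. Cauchy–Schwarz on `T ×ˢ
  -- T` bounds the first by a Frobenius norm.
  have e1 : ∑ i ∈ T, ∑ j ∈ T, a i * (sampleCov X i j - popCov σ θ i j) * b j =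
      ∑ q ∈ T ×ˢ T, M q.1 q.2 * (a q.1 * b q.2) - (∑ i ∈ T, y i * a i) * ∑ i ∈ T, y i * b i := by
    rw [Finset.sum_product, Finset.sum_mul_sum, ← Finset.sum_sub_distrib]
    refine Finset.sum_congr rfl fun i _ => ?_
    rw [← Finset.sum_sub_distrib]
    refine Finset.sum_congr rfl fun j _ => ?_
    rw [hE]; ring
  have h1 : |∑ q ∈ T ×ˢ T, M q.1 q.2 * (a q.1 * b q.2)| ≤
      √(frobNoise σ θ S X) * (√(∑ i ∈ T, a i ^ 2) * √(∑ i ∈ T, b i ^ 2)) := by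
    refine (abs_sum_mul_le_sqrt_mul_sqrt _ _ _).trans ?_
    rw [Finset.sum_product, Finset.sum_product, ← Real.sqrt_mul
      (Finset.sum_nonneg fun i _ => sq_nonneg _), Finset.sum_mul_sum]
    simp only [mul_pow]
    gcongr
    exact frobNoise_mono hTS
  have h2 (c : Fin d → ℝ) : |∑ i ∈ T, y i * c i| ≤ √(meanNoise θ S X) * √(∑ i ∈ T, c i ^ 2) := by
    refine (abs_sum_mul_le_sqrt_mul_sqrt _ _ _).trans ?_
    gcongr
    exact meanNoise_mono hTS
  rw [e1]
  calc _ ≤ |∑ q ∈ T ×ˢ T, M q.1 q.2 * (a q.1 * b q.2)| +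
        |∑ i ∈ T, y i * a i| * |∑ i ∈ T, y i * b i| := by
        rw [← abs_mul]; exact abs_sub _ _
    _ ≤ √(frobNoise σ θ S X) * (√(∑ i ∈ T, a i ^ 2) * √(∑ i ∈ T, b i ^ 2)) +
        (√(meanNoise θ S X) * √(∑ i ∈ T, a i ^ 2)) *
          (√(meanNoise θ S X) * √(∑ i ∈ T, b i ^ 2)) := by
        gcongr
        · exact h2 a
        · exact h2 b
    _ = √(frobNoise σ θ S X) * (√(∑ i ∈ T, a i ^ 2) * √(∑ i ∈ T, b i ^ 2)) +
        √(meanNoise θ S X) ^ 2 * (√(∑ i ∈ T, a i ^ 2) * √(∑ i ∈ T, b i ^ 2)) := by ring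
    _ = _ := by rw [Real.sq_sqrt (meanNoise_nonneg S)]; ring

lemma sampleCov_symm (i j : Fin d) : sampleCov X i j = sampleCov X j i := by
  simp [sampleCov, mul_comm]

/-- The loss of the clusterer on a sample for which the selection is correct up to a fraction `η²`
of the signal. -/
lemma loss_clusterer_le (hσ : 0 < σ) (hn : n ≠ 0) (hm : halfDiff θ ≠ 0)
    {v : EuclideanSpace ℝ (Fin d)}
    (hv : IsLeadingEigenvector (restrict (selected X) (sampleCov X)) v)
    {S : Finset (Fin d)} (hTS : selected X ⊆ S) {η ρ : ℝ} (hρ : ρ = ‖halfDiff θ‖)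
    (hη0 : 0 ≤ η) (hη : η ≤ 1 / 2)
    (hmiss : (1 - η ^ 2) * ρ ^ 2 ≤ ∑ i ∈ selected X, halfDiff θ i ^ 2) :
    loss σ θ (clusterer X v) ≤ ENNReal.ofReal (2 * η +
      4 * (√(frobNoise σ θ S X) + meanNoise θ S X) / ρ ^ 2 +
      4 * √(meanNoise θ S X) / max ρ σ) := by
  have hρ0 : 0 < ρ := by rw [hρ]; exact norm_pos_iff.2 hm
  have hmax : 0 < max ρ σ := lt_max_of_lt_right hσ
  set D := √(frobNoise σ θ S X) + meanNoise θ S X with hD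
  have hD0 : 0 ≤ D := add_nonneg (Real.sqrt_nonneg _) (meanNoise_nonneg S)
  set x := D / ρ ^ 2 with hx
  have hx0 : 0 ≤ x := by positivity
  have hN0 : 0 ≤ 4 * √(meanNoise θ S X) / max ρ σ := by positivity
  have e4 : 4 * D / ρ ^ 2 = 4 * x := by rw [hx]; ring
  rw [e4]
  -- For `x ≥ 1 / 4` the bound exceeds 1 and is trivial.
  rcases le_or_gt (1 / 4) x with hx4 | hx4
  · refine (loss_le_one _).trans ?_
    rw [← ENNReal.ofReal_one]
    exact ENNReal.ofReal_le_ofReal (by linarith)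
  set T := selected X with hT
  set p := ∑ i ∈ T, halfDiff θ i ^ 2 with hp
  set g := ∑ i ∈ T, halfDiff θ i * v i with hg
  have hp34 : 3 / 4 * ρ ^ 2 ≤ p := by
    refine le_trans ?_ hmiss
    gcongr
    nlinarith
  have hρ2 : 0 < ρ ^ 2 := by positivity
  have hp0 : 0 < p := by linarith
  have hang := leadingEigenvector_angle T (sampleCov_symm (X := X)) (halfDiff θ) (σ := σ) (D := D)
    hv (fun a b => sampleCov_bilin_le (σ := σ) hn hTS a b) hp0
  rw [← hp, ← hg] at hang
  set w : EuclideanSpace ℝ (Fin d) := WithLp.toLp 2 (fun i => if i ∈ T then v i else 0) with hw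
  have hinner (z : EuclideanSpace ℝ (Fin d)) : ⟪w, z⟫ = ∑ i ∈ T, z i * v i := by
    simp [PiLp.inner_apply, hw, Finset.sum_ite_mem]
  have hw1 : ‖w‖ ^ 2 ≤ 1 := by
    have h1 := EuclideanSpace.real_norm_sq_eq v
    rw [hv.1] at h1
    rw [EuclideanSpace.real_norm_sq_eq]
    calc _ ≤ ∑ i, v i ^ 2 := by
          apply Finset.sum_le_sum
          intro i _
          simp only [hw]
          split_ifs
          · exact le_rfl
          · simpa using sq_nonneg (v i)
      _ = 1 := by linarith
  set κ := g / ρ with hκ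
  set c := center θ with hc
  have hgp : p - g ^ 2 ≤ 16 / 3 * (D ^ 2 / ρ ^ 2) := by
    by_contra hcon
    rw [not_le] at hcon
    have h0 : 0 ≤ D ^ 2 / ρ ^ 2 := by positivity
    have h1 : 3 / 4 * ρ ^ 2 * (16 / 3 * (D ^ 2 / ρ ^ 2)) < p * (p - g ^ 2) :=
      mul_lt_mul' hp34 hcon (by positivity) hp0
    have h2 : 3 / 4 * ρ ^ 2 * (16 / 3 * (D ^ 2 / ρ ^ 2)) = 4 * D ^ 2 := by field_simp; norm_num
    linarith
  -- The squared sine splits into the signal lost in selection, `ρ² - p`, and the eigenvector error,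
  -- `p - g²`.
  have hκ2 : 1 - κ ^ 2 ≤ η ^ 2 + 16 / 3 * x ^ 2 := by
    have h1 : ρ ^ 2 * κ ^ 2 = g ^ 2 := by rw [hκ]; field_simp
    have h2 : ρ ^ 2 * x ^ 2 = D ^ 2 / ρ ^ 2 := by rw [hx]; field_simp
    have h3 : ρ ^ 2 * (1 - κ ^ 2) ≤ ρ ^ 2 * (η ^ 2 + 16 / 3 * x ^ 2) := by linarith
    exact le_of_mul_le_mul_left h3 hρ2
  -- From `η ≤ 1 / 2` and `x < 1 / 4`, `κ² ≥ 1 - 1 / 4 - 1 / 3 = 5 / 12`.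
  have hκlow : 25 / 64 ≤ κ ^ 2 := by nlinarith
  have hκabs : 5 / 8 ≤ |κ| := by
    apply le_of_sq_le_sq _ (abs_nonneg κ)
    rw [sq_abs]; linarith
  have hκ0 : κ ≠ 0 := by
    intro h0; rw [h0] at hκlow; norm_num at hκlow
  -- `12 / 5` is chosen because `(12 / 5)² ≥ 16 / 3` while `(12 / 5) / (5 / 8) ≤ 4`.
  refine (loss_linear_le hσ hm (w := w) (b := ⟪w, sampleMean X - c⟫) (κ := κ)
    (τ := η + 12 / 5 * x) (ρ := ρ) (h := √(meanNoise θ S X)) hρ ?_ ?_ ?_ hκ0 (by positivity)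
    ?_).trans (ENNReal.ofReal_le_ofReal ?_)
  · intro z
    have h1 : clusterer X v z = 0 ↔ ∑ i ∈ T, sampleMean X i * v i ≤ ∑ i ∈ T, z i * v i := by
      unfold clusterer; split_ifs with h <;> simp [h, hT]
    rw [h1, ← hc, inner_sub_right w z c, inner_sub_right w (sampleMean X) c, hinner z,
      hinner (sampleMean X), sub_le_sub_iff_right]
  · rw [hinner]
    refine (abs_sum_mul_le_sqrt_mul_sqrt _ _ _).trans ?_
    have h1 : ∑ i ∈ T, v i ^ 2 ≤ 1 := by
      have h1 := EuclideanSpace.real_norm_sq_eq v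
      rw [hv.1] at h1
      calc _ ≤ ∑ i, v i ^ 2 := Finset.sum_le_sum_of_subset_of_nonneg (Finset.subset_univ T)
            fun i _ _ => sq_nonneg _
        _ = 1 := by linarith
    calc _ ≤ √(meanNoise θ S X) * 1 := by
          gcongr
          · exact meanNoise_mono hTS
          · exact Real.sqrt_le_one.2 h1
      _ = _ := mul_one _
  · rw [real_inner_comm, hinner, hκ]; field_simp; rfl
  · nlinarith [mul_nonneg hη0 hx0]
  · have h1 : (η + 12 / 5 * x) / |κ| ≤ 2 * η + 4 * x := by
      rw [div_le_iff₀ (by linarith)]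
      nlinarith [mul_le_mul_of_nonneg_left hκabs (show 0 ≤ 2 * η + 4 * x by positivity)]
    have h2 : 2 * √(meanNoise θ S X) / (|κ| * max ρ σ) ≤ 4 * √(meanNoise θ S X) / max ρ σ := by
      rw [← div_div]
      gcongr
      rw [div_le_iff₀ (by linarith)]
      nlinarith [mul_le_mul_of_nonneg_left hκabs (Real.sqrt_nonneg (meanNoise θ S X)),
        Real.sqrt_nonneg (meanNoise θ S X)]
    linarith

end

/-! ### Integrated risk and comparison with the rate. -/

section

variable {d n : ℕ} {σ : ℝ} {θ : EuclideanSpace ℝ (Fin d) × EuclideanSpace ℝ (Fin d)}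

lemma alpha_bounds {n d : ℕ} (hnd : 1 ≤ n * d) (hα : alpha n d ≤ 1 / 4) :
    0 ≤ alpha n d ∧ alpha n d ≤ 3 * √(Real.log ((n : ℝ) * d) / n) := by
  have hL : 0 ≤ Real.log ((n : ℝ) * d) := Real.log_nonneg (by exact_mod_cast hnd)
  set a := √(Real.log ((n : ℝ) * d) / n) with ha
  have ha0 : 0 ≤ a := Real.sqrt_nonneg _
  have ha2 : a ^ 2 = Real.log ((n : ℝ) * d) / n := Real.sq_sqrt (by positivity)
  have hαe : alpha n d = √6 * a + 2 * a ^ 2 := by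
    rw [alpha, ha2, ha, ← Real.sqrt_mul (by norm_num)]
    congr 1
    · congr 1; ring
    · ring
  have h6 : 2 ≤ √6 := Real.le_sqrt_of_sq_le (by norm_num)
  have h6' : √6 ≤ 5 / 2 := (Real.sqrt_le_left (by norm_num)).2 (by norm_num)
  rw [hαe] at hα ⊢
  refine ⟨by positivity, ?_⟩
  have h1 : a ≤ 1 / 8 := by nlinarith [mul_le_mul_of_nonneg_right h6 ha0, sq_nonneg a]
  nlinarith [mul_le_mul_of_nonneg_right h6' ha0]

/-- The risk of the clusterer, for a parameter whose coordinates missed by the selection carry at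
most a fraction `η²` of the signal. -/
lemma lintegral_loss_clusterer_le (hσ : 0 < σ) (hd : 0 < d) (hn : 0 < n)
    (hα0 : 0 ≤ alpha n d) (hα : alpha n d ≤ 1 / 4) (hm : halfDiff θ ≠ 0)
    {v : (Fin n → EuclideanSpace ℝ (Fin d)) → EuclideanSpace ℝ (Fin d)}
    (hv : ∀ X, IsLeadingEigenvector (restrict (selected X) (sampleCov X)) (v X))
    {s : ℕ} (hsd : s < d) (hs : hammingNorm (fun i => halfDiff θ i) ≤ s)
    {η ρ c₁ c₂ : ℝ} (hρ : ρ = ‖halfDiff θ‖) (hη0 : 0 ≤ η) (hη : η ≤ 1 / 2)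
    (hmiss : s * (64 / 9 * alpha n d * σ ^ 2) ≤ η ^ 2 * ρ ^ 2) (hc₁ : 0 < c₁) (hc₂ : 0 < c₂)
    (h₁ : (n : ℝ)⁻¹ * (4 * s * σ ^ 2 * ρ ^ 2 + 2 * s ^ 2 * σ ^ 4) ≤ c₁ ^ 2)
    (h₂ : (n : ℝ)⁻¹ * (ρ ^ 2 + s * σ ^ 2) ≤ c₂ ^ 2) :
    ∫⁻ X, loss σ θ (clusterer X (v X)) ∂(sampleLaw σ n θ) ≤
      ENNReal.ofReal (2 * η + 4 / ρ ^ 2 * (c₁ + c₂ ^ 2) + 4 / max ρ σ * c₂ + 4 / n) := by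
  have hρ0 : 0 < ρ := by rw [hρ]; exact norm_pos_iff.2 hm
  have hmax : 0 < max ρ σ := lt_max_of_lt_right hσ
  have : IsProbabilityMeasure (sampleLaw σ n θ) := by unfold sampleLaw; infer_instance
  set S : Finset (Fin d) := Finset.univ.filter fun i => halfDiff θ i ≠ 0 with hS
  have hScard : S.card ≤ s := hs
  have hScard' : (S.card : ℝ) ≤ s := by exact_mod_cast hScard
  -- Sparsity below the dimension provides the pure-noise coordinate that keeps the threshold near
  -- `σ²`.
  obtain ⟨i₀, hi₀⟩ : ∃ i, halfDiff θ i = 0 := by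
    by_contra! hcon
    have : S = Finset.univ := by
      rw [hS, Finset.filter_true_of_mem fun i _ => hcon i]
    rw [this, Finset.card_univ, Fintype.card_fin] at hScard
    omega
  have hR : ∑ i ∈ S, halfDiff θ i ^ 2 = ρ ^ 2 := by
    rw [hρ, EuclideanSpace.real_norm_sq_eq]
    apply Finset.sum_subset (Finset.subset_univ S)
    intro i _ hi
    have : halfDiff θ i = 0 := by simpa [hS] using hi
    rw [this]; norm_num
  obtain ⟨hFi, hF⟩ := integral_frobNoise_le σ θ S hn.ne' hR.le
  obtain ⟨hNi, hN⟩ := integral_meanNoise_le σ θ S hn.ne' hR.le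
  have hF' : ∫ X, frobNoise σ θ S X ∂(sampleLaw σ n θ) ≤ c₁ ^ 2 :=
    hF.trans (le_trans (by gcongr) h₁)
  have hN' : ∫ X, meanNoise θ S X ∂(sampleLaw σ n θ) ≤ c₂ ^ 2 :=
    hN.trans (le_trans (by gcongr) h₂)
  -- Makes the bound affine in the noises. When the mean of `t` is at most `c²`, the right side
  -- integrates to at most `c`, as Jensen's inequality would give.
  have hamgm (c t : ℝ) (hc : 0 < c) (ht : 0 ≤ t) : √t ≤ t / (2 * c) + c / 2 := by
    rw [div_add_div _ _ (by positivity) (by positivity), le_div_iff₀ (by positivity)]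
    nlinarith [sq_nonneg (√t - c), Real.sq_sqrt ht]
  set Good : Set (Fin n → EuclideanSpace ℝ (Fin d)) := {X | ∀ i,
        (1 - alpha n d) * (halfDiff θ i ^ 2 + σ ^ 2) ≤ sampleCov X i i ∧
        sampleCov X i i ≤ (1 + alpha n d) * (halfDiff θ i ^ 2 + σ ^ 2)} with hGood
  set H : (Fin n → EuclideanSpace ℝ (Fin d)) → ℝ := fun X => (2 * η + 2 / ρ ^ 2 * c₁ +
    2 / max ρ σ * c₂) + (2 / (ρ ^ 2 * c₁) * frobNoise σ θ S X +
    (4 / ρ ^ 2 + 2 / (max ρ σ * c₂)) * meanNoise θ S X) with hH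
  have hF0 (X : Fin n → EuclideanSpace ℝ (Fin d)) : 0 ≤ frobNoise σ θ S X :=
    Finset.sum_nonneg fun _ _ => Finset.sum_nonneg fun _ _ => sq_nonneg _
  have hN0 (X : Fin n → EuclideanSpace ℝ (Fin d)) : 0 ≤ meanNoise θ S X := meanNoise_nonneg S
  have hH0 (X : Fin n → EuclideanSpace ℝ (Fin d)) : 0 ≤ H X := by
    have := hF0 X
    have := hN0 X
    simp only [hH]
    positivity
  have hgood (X : Fin n → EuclideanSpace ℝ (Fin d)) (hX : X ∈ Good) :
      loss σ θ (clusterer X (v X)) ≤ ENNReal.ofReal (H X) := by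
    have hTS : selected X ⊆ S := by
      intro i hi
      simp only [hS, Finset.mem_filter, Finset.mem_univ, true_and]
      exact halfDiff_ne_zero_of_mem_selected hα0 hα hd hX hi
    have hmissX : (1 - η ^ 2) * ρ ^ 2 ≤ ∑ i ∈ selected X, halfDiff θ i ^ 2 := by
      have h1 := Finset.sum_sdiff (f := fun i => halfDiff θ i ^ 2) hTS
      have h2 : ∑ i ∈ S \ selected X, halfDiff θ i ^ 2 ≤ s * (64 / 9 * alpha n d * σ ^ 2) := by
        calc _ ≤ ∑ i ∈ S \ selected X, 64 / 9 * alpha n d * σ ^ 2 := by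
              refine Finset.sum_le_sum fun i hi => ?_
              exact halfDiff_sq_le_of_notMem_selected hα0 hα hX hi₀ (Finset.mem_sdiff.1 hi).2
          _ = ((S \ selected X).card : ℝ) * (64 / 9 * alpha n d * σ ^ 2) := by
              rw [Finset.sum_const, nsmul_eq_mul]
          _ ≤ _ := by
              gcongr
              exact (Finset.card_le_card Finset.sdiff_subset).trans hScard
      rw [hR] at h1
      linarith
    refine (loss_clusterer_le hσ hn.ne' hm (hv X) hTS hρ hη0 hη hmissX).trans
      (ENNReal.ofReal_le_ofReal ?_)
    have k1 := hamgm c₁ _ hc₁ (hF0 X)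
    have k2 := hamgm c₂ _ hc₂ (hN0 X)
    calc _ ≤ 2 * η + 4 * (frobNoise σ θ S X / (2 * c₁) + c₁ / 2 + meanNoise θ S X) / ρ ^ 2 +
          4 * (meanNoise θ S X / (2 * c₂) + c₂ / 2) / max ρ σ := by gcongr
      _ = H X := by simp only [hH]; field_simp; ring
  have hall (X : Fin n → EuclideanSpace ℝ (Fin d)) :
      loss σ θ (clusterer X (v X)) ≤ ENNReal.ofReal (H X) + Goodᶜ.indicator 1 X := by
    by_cases hX : X ∈ Good
    · exact (hgood X hX).trans le_self_add
    · have : Goodᶜ.indicator (1 : (Fin n → EuclideanSpace ℝ (Fin d)) → ℝ≥0∞) X = 1 := Set.indicator_of_mem hX 1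
      rw [this]
      exact (loss_le_one _).trans le_add_self
  have hHi : Integrable H (sampleLaw σ n θ) :=
    (integrable_const _).add ((hFi.const_mul _).add (hNi.const_mul _))
  have hHle : ∫ X, H X ∂(sampleLaw σ n θ) ≤
      2 * η + 4 / ρ ^ 2 * (c₁ + c₂ ^ 2) + 4 / max ρ σ * c₂ := by
    have e : ∫ X, H X ∂(sampleLaw σ n θ) = (2 * η + 2 / ρ ^ 2 * c₁ +
        2 / max ρ σ * c₂) + (2 / (ρ ^ 2 * c₁) * ∫ X, frobNoise σ θ S X ∂(sampleLaw σ n θ) +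
        (4 / ρ ^ 2 + 2 / (max ρ σ * c₂)) * ∫ X, meanNoise θ S X ∂(sampleLaw σ n θ)) := by
      simp only [hH]
      rw [integral_add (integrable_const _)
          (f := fun _ => 2 * η + 2 / ρ ^ 2 * c₁ + 2 / max ρ σ * c₂)
          (g := fun X => 2 / (ρ ^ 2 * c₁) * frobNoise σ θ S X +
            (4 / ρ ^ 2 + 2 / (max ρ σ * c₂)) * meanNoise θ S X)
          ((hFi.const_mul _).add (hNi.const_mul _)),
        integral_add (hFi.const_mul _) (hNi.const_mul _), integral_const_mul,
        integral_const_mul]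
      simp
    rw [e]
    calc _ ≤ (2 * η + 2 / ρ ^ 2 * c₁ + 2 / max ρ σ * c₂) + (2 / (ρ ^ 2 * c₁) * c₁ ^ 2 +
          (4 / ρ ^ 2 + 2 / (max ρ σ * c₂)) * c₂ ^ 2) := by gcongr
      _ = _ := by field_simp; ring
  calc _ ≤ ∫⁻ X, (ENNReal.ofReal (H X) + Goodᶜ.indicator 1 X) ∂(sampleLaw σ n θ) :=
        lintegral_mono hall
    -- Only `H` has to be measurable here; nothing is assumed about the measurability of the
    -- eigenvector choice `v`.
    _ = ∫⁻ X, ENNReal.ofReal (H X) ∂(sampleLaw σ n θ) +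
          ∫⁻ X, Goodᶜ.indicator 1 X ∂(sampleLaw σ n θ) :=
        lintegral_add_left' hHi.aestronglyMeasurable.aemeasurable.ennreal_ofReal _
    _ ≤ ENNReal.ofReal (2 * η + 4 / ρ ^ 2 * (c₁ + c₂ ^ 2) + 4 / max ρ σ * c₂) +
          ENNReal.ofReal (4 / n) := by
        gcongr
        · rw [← ofReal_integral_eq_lintegral_ofReal hHi (Filter.Eventually.of_forall hH0)]
          exact ENNReal.ofReal_le_ofReal hHle
        · exact (lintegral_indicator_one_le _).trans (sampleCov_diag_concentration hd hn hσ θ)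
    _ = _ := by rw [← ENNReal.ofReal_add (by positivity) (by positivity)]

/-- The choice `η = 10 q` works because `64 / 9 * 3 * 4 < 10²`; the 4 comes from `lam ≤ 2 ρ`. -/
lemma missed_signal_le {σ lam ρ s a al q : ℝ} (hs : 0 ≤ s) (hlam : 0 < lam) (hal : al ≤ 3 * a)
    (hρ : lam ≤ 2 * ρ) (hq : q ^ 2 = σ ^ 2 * s / lam ^ 2 * a) :
    s * (64 / 9 * al * σ ^ 2) ≤ (10 * q) ^ 2 * ρ ^ 2 := by
  have h3 : lam ^ 2 ≤ 4 * ρ ^ 2 := by nlinarith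
  have h1 : s * σ ^ 2 * a = q ^ 2 * lam ^ 2 := by rw [hq]; field_simp
  have h2 : s * σ ^ 2 * al ≤ s * σ ^ 2 * (3 * a) := by gcongr
  have h4 : q ^ 2 * lam ^ 2 ≤ q ^ 2 * (4 * ρ ^ 2) := by gcongr
  have h5 : 0 ≤ q ^ 2 * ρ ^ 2 := by positivity
  linarith

lemma frobNoise_budget {σ ρ s n e b : ℝ} (hσ : 0 ≤ σ) (hρ : 0 ≤ ρ) (hs : 0 ≤ s) (hn : 0 < n)
    (he : 0 ≤ e) (hb : 0 ≤ b) (he2 : e ^ 2 = s / n) (hb2 : b ^ 2 = 1 / n) :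
    n⁻¹ * (4 * s * σ ^ 2 * ρ ^ 2 + 2 * s ^ 2 * σ ^ 4) ≤
      (2 * e * σ * ρ + 2 * σ ^ 2 * s * b) ^ 2 := by
  have h1 : n⁻¹ * (4 * s * σ ^ 2 * ρ ^ 2 + 2 * s ^ 2 * σ ^ 4) =
      4 * e ^ 2 * σ ^ 2 * ρ ^ 2 + 2 * s ^ 2 * σ ^ 4 * b ^ 2 := by
    rw [he2, hb2]; field_simp
  have h2 : 0 ≤ e * σ * ρ * (σ ^ 2 * s * b) := by positivity
  have h3 : 0 ≤ s ^ 2 * σ ^ 4 * b ^ 2 := by positivity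
  rw [h1]
  linarith

lemma meanNoise_budget {σ ρ s n e : ℝ} (hσ : 0 ≤ σ) (hρ : 0 ≤ ρ) (hs : 1 ≤ s) (hn : 0 < n)
    (he2 : e ^ 2 = s / n) :
    n⁻¹ * (ρ ^ 2 + s * σ ^ 2) ≤ (e * (ρ + σ)) ^ 2 := by
  have h1 : n⁻¹ * (ρ ^ 2 + s * σ ^ 2) ≤ n⁻¹ * (s * ρ ^ 2 + s * σ ^ 2) := by
    gcongr
    exact le_mul_of_one_le_left (sq_nonneg ρ) hs
  have h2 : n⁻¹ * (s * ρ ^ 2 + s * σ ^ 2) = e ^ 2 * (ρ ^ 2 + σ ^ 2) := by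
    rw [he2]; field_simp
  have h3 : 0 ≤ e ^ 2 * (ρ * σ) := by positivity
  rw [h2] at h1
  linarith

lemma rate_le {σ lam ρ s n a b e q K δ : ℝ} (hσ : 0 < σ) (hlam : 0 < lam) (hs : 1 ≤ s)
    (hn : 0 < n) (hρlam : lam ≤ 2 * ρ) (he0 : 0 ≤ e) (hb0 : 0 ≤ b) (hq0 : 0 ≤ q) (heδ : e ≤ δ)
    (he12 : e ≤ 1 / 2) (hba : b ≤ a) (hqs : q ≤ 1 / 220) (hK1 : 1 ≤ K)
    (hK : 16 * σ ^ 2 / lam ^ 2 ≤ K) (he2 : e ^ 2 = s / n)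
    (hq2 : q ^ 2 = σ ^ 2 * s / lam ^ 2 * a) :
    2 * (10 * q) + 4 / ρ ^ 2 * (2 * e * σ * ρ + 2 * σ ^ 2 * s * b + (e * (ρ + σ)) ^ 2) +
      4 / max ρ σ * (e * (ρ + σ)) + 4 / n ≤ 603 * K * δ + 220 * q := by
  have hρ0 : 0 < ρ := by linarith
  have hδ0 : 0 ≤ δ := he0.trans heδ
  have ha0 : 0 ≤ a := hb0.trans hba
  have hKδ : 0 ≤ K * δ := by positivity
  obtain ⟨x, hx⟩ : ∃ x, x = σ / ρ := ⟨_, rfl⟩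
  have hx0 : 0 ≤ x := by rw [hx]; positivity
  have hx2 : x ^ 2 ≤ 4 * σ ^ 2 / lam ^ 2 := by
    rw [hx, div_pow, div_le_div_iff₀ (by positivity) (by positivity)]
    have h3 : lam ^ 2 ≤ 4 * ρ ^ 2 := by nlinarith
    nlinarith [mul_le_mul_of_nonneg_left h3 (sq_nonneg σ)]
  have hx2K : x ^ 2 ≤ K / 4 := by
    have h4 : 4 * σ ^ 2 / lam ^ 2 = 16 * σ ^ 2 / lam ^ 2 / 4 := by ring
    linarith
  have hxK : x ≤ K := by nlinarith [sq_nonneg (x - 1)]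
  -- The pure-noise term `s σ² / (ρ² √n)` is not charged to `δ`: since `b ≤ a` it is of order `q²`,
  -- hence at most a small multiple of `q`.
  have hsbx : s * b * x ^ 2 ≤ 4 * q ^ 2 := by
    calc s * b * x ^ 2 ≤ s * a * (4 * σ ^ 2 / lam ^ 2) := by gcongr
      _ = _ := by rw [hq2]; ring
  have t1 : 4 / ρ ^ 2 * (2 * e * σ * ρ + 2 * σ ^ 2 * s * b + (e * (ρ + σ)) ^ 2) =
      8 * e * x + 8 * (s * b * x ^ 2) + 4 * e ^ 2 * (1 + x) ^ 2 := by
    rw [hx]; field_simp; ring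
  have t2 : 4 / max ρ σ * (e * (ρ + σ)) ≤ 8 * e := by
    -- The maximum in the anti-concentration bound matters here: `ρ + σ ≤ 2 max ρ σ`, so the offset
    -- costs `8 e` at every signal-to-noise ratio.
    have hmax : 0 < max ρ σ := lt_max_of_lt_right hσ
    rw [div_mul_eq_mul_div, div_le_iff₀ hmax]
    nlinarith [mul_le_mul_of_nonneg_left (le_max_left ρ σ) he0,
      mul_le_mul_of_nonneg_left (le_max_right ρ σ) he0]
  have t3 : 4 / n ≤ 2 * e := by
    have h1 : 1 / n ≤ e ^ 2 := by rw [he2]; gcongr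
    have h2 : 4 / n = 4 * (1 / n) := by ring
    have h3 : e ^ 2 ≤ e * (1 / 2) := by rw [pow_two]; gcongr
    linarith
  have t4 : 4 * e ^ 2 * (1 + x) ^ 2 ≤ 4 * e * (1 + x ^ 2) := by
    have h1 : e ^ 2 ≤ e * (1 / 2) := by rw [pow_two]; gcongr
    have h2 : (1 + x) ^ 2 ≤ 2 * (1 + x ^ 2) := by nlinarith [sq_nonneg (1 - x)]
    calc 4 * e ^ 2 * (1 + x) ^ 2 ≤ 4 * (e * (1 / 2)) * (2 * (1 + x ^ 2)) := by gcongr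
      _ = _ := by ring
  have t5 : e * x ≤ K * δ := by
    calc e * x ≤ δ * K := by gcongr
      _ = _ := mul_comm _ _
  have t6 : e ≤ K * δ := heδ.trans (le_mul_of_one_le_left hδ0 hK1)
  have t7 : e * x ^ 2 ≤ K * δ := by
    calc e * x ^ 2 ≤ δ * (K / 4) := by gcongr
      _ ≤ _ := by linarith
  have t8 : q ^ 2 ≤ q * (1 / 220) := by rw [pow_two]; gcongr
  rw [t1]
  -- The terms add up to at most `26 K δ + 21 q`, well inside the stated constants.
  linarith

end

end SparseMixture

/-! ### The main theorem. -/

theorem theorem3 (d n s : ℕ) (σ lam : ℝ) (hσ : 0 < σ) (hlam : 0 < lam)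
    (hs : 1 ≤ s) (hsd : s < d) (hd : 2 ≤ d) (hn : max 68 (4 * s) ≤ n)
    (hα : SparseMixture.alpha n d ≤ 1 / 4)
    (v : (Fin n → EuclideanSpace ℝ (Fin d)) → EuclideanSpace ℝ (Fin d))
    (hv : ∀ X : Fin n → EuclideanSpace ℝ (Fin d),
      SparseMixture.IsLeadingEigenvector
        (SparseMixture.restrict (SparseMixture.selected X) (SparseMixture.sampleCov X)) (v X)) :
    (⨆ θ ∈ SparseMixture.sparseClass d lam s,
      ∫⁻ X, SparseMixture.loss σ θ (SparseMixture.clusterer X (v X))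
        ∂(SparseMixture.sampleLaw σ n θ))
      ≤ ENNReal.ofReal
        (603 * max (16 * σ ^ 2 / lam ^ 2) 1 *
            Real.sqrt ((s : ℝ) * Real.log ((n : ℝ) * s) / n) +
          220 * (σ * Real.sqrt s / lam) *
            (Real.log ((n : ℝ) * d) / n) ^ ((1 : ℝ) / 4)) := by
  refine iSup₂_le fun θ hθ => ?_
  obtain ⟨hθlam, hθs⟩ := hθ
  have hn68 : 68 ≤ n := (le_max_left _ _).trans hn
  have hn4s : 4 * s ≤ n := (le_max_right _ _).trans hn
  have hnR : (68 : ℝ) ≤ n := by exact_mod_cast hn68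
  have hn0 : (0 : ℝ) < n := by linarith
  have hsR : (1 : ℝ) ≤ s := by exact_mod_cast hs
  have hdR : (2 : ℝ) ≤ d := by exact_mod_cast hd
  have hn4sR : 4 * (s : ℝ) ≤ n := by exact_mod_cast hn4s
  -- Logarithms of at least 1 allow `√(s / n)` and `1 / √n` to be absorbed into the rates `δ` and
  -- `a`.
  have hlog (t : ℝ) (ht : 1 ≤ t) : 1 ≤ Real.log (n * t) := by
    rw [Real.le_log_iff_exp_le (by positivity)]
    nlinarith [Real.exp_one_lt_d9]
  have hL1 := hlog d (by linarith)
  have hLs := hlog s hsR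
  set K := max (16 * σ ^ 2 / lam ^ 2) 1 with hK
  have hK1 : 1 ≤ K := le_max_right _ _
  set δ := √((s : ℝ) * Real.log ((n : ℝ) * s) / n) with hδ
  set y := (Real.log ((n : ℝ) * d) / n) ^ ((1 : ℝ) / 4) with hy
  set a := √(Real.log ((n : ℝ) * d) / n) with ha
  have hy2 : y ^ 2 = a := by
    rw [hy, ha, Real.sqrt_eq_rpow, ← Real.rpow_natCast, ← Real.rpow_mul (by positivity)]
    norm_num
  have hy0 : 0 ≤ y := by positivity
  set q := σ * √s / lam * y with hq
  have hq0 : 0 ≤ q := by positivity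
  have hq2 : q ^ 2 = σ ^ 2 * s / lam ^ 2 * a := by
    rw [hq, mul_pow, hy2, div_pow, mul_pow, Real.sq_sqrt (by positivity)]
  have hδ0 : 0 ≤ δ := Real.sqrt_nonneg _
  have hRHS : 603 * K * δ + 220 * (σ * √s / lam) * y = 603 * K * δ + 220 * q := by
    rw [hq]; ring
  rw [hRHS]
  have hP : MeasureTheory.IsProbabilityMeasure (SparseMixture.sampleLaw σ n θ) := by
    unfold SparseMixture.sampleLaw; infer_instance
  rcases le_or_gt 1 (603 * K * δ + 220 * q) with hbig | hsmall
  · calc _ ≤ ∫⁻ _, 1 ∂(SparseMixture.sampleLaw σ n θ) :=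
          MeasureTheory.lintegral_mono fun X => SparseMixture.loss_le_one _
      _ = ENNReal.ofReal 1 := by simp
      _ ≤ _ := ENNReal.ofReal_le_ofReal hbig
  have hKδ : 0 ≤ K * δ := by positivity
  -- In the nontrivial case `η = 10 q ≤ 1 / 22`, so the selection keeps most of the signal.
  have hqs : q ≤ 1 / 220 := by nlinarith
  set ρ := ‖SparseMixture.halfDiff θ‖ with hρ
  have hρlam : lam ≤ 2 * ρ := by
    rw [hρ, SparseMixture.halfDiff, norm_smul]
    norm_num
    linarith
  have hρ0 : 0 < ρ := by linarith
  have hm : SparseMixture.halfDiff θ ≠ 0 := norm_pos_iff.1 hρ0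
  have hham : hammingNorm (fun i => SparseMixture.halfDiff θ i) ≤ s := by
    refine le_trans (le_of_eq ?_) hθs
    simp [hammingNorm, SparseMixture.halfDiff]
  obtain ⟨hα0, hα3⟩ := SparseMixture.alpha_bounds (n := n) (d := d)
    (Nat.mul_pos (by omega) (by omega)) hα
  set e := √((s : ℝ) / n) with he
  have he0 : 0 < e := Real.sqrt_pos.2 (by positivity)
  have he2 : e ^ 2 = s / n := Real.sq_sqrt (by positivity)
  set b := 1 / √(n : ℝ) with hb
  have hb0 : 0 < b := by positivity
  have hb2 : b ^ 2 = 1 / n := by rw [hb, div_pow, Real.sq_sqrt hn0.le, one_pow]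
  have hmiss := SparseMixture.missed_signal_le (σ := σ) (by linarith) hlam hα3 hρlam hq2
  have hrisk := SparseMixture.lintegral_loss_clusterer_le hσ (by omega) (by omega) hα0 hα hm hv
    hsd hham (η := 10 * q) (c₁ := 2 * e * σ * ρ + 2 * σ ^ 2 * s * b) (c₂ := e * (ρ + σ)) hρ
    (by positivity) (by linarith) hmiss (by positivity) (by positivity)
    (SparseMixture.frobNoise_budget hσ.le hρ0.le (by linarith) hn0 he0.le hb0.le he2 hb2)
    (SparseMixture.meanNoise_budget hσ.le hρ0.le hsR hn0 he2)
  refine hrisk.trans (ENNReal.ofReal_le_ofReal ?_)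
  have heδ : e ≤ δ := by
    apply Real.sqrt_le_sqrt
    gcongr
    exact le_mul_of_one_le_right (by positivity) hLs
  have he12 : e ≤ 1 / 2 := by
    rw [he, Real.sqrt_le_left (by norm_num), div_le_iff₀ hn0]
    linarith
  have hba : b ≤ a := by
    rw [hb, ha, ← Real.sqrt_one, ← Real.sqrt_div (by norm_num)]
    apply Real.sqrt_le_sqrt
    gcongr
  exact SparseMixture.rate_le hσ hlam hsR hn0 hρlam he0.le hb0.le hq0 heδ he12 hba hqs hK1
    (le_max_left _ _) he2 hq2
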